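/- Let $K$ be any field, $R=K[x_0,\dots,x_n]$ with the standard grading, and let $Z\subset\mathbb P^n=\mathbb P^n(K)$ be a finite set of points spanning $\mathbb P^n$. For a point $P$ let $I_P\subset R$ be its homogeneous ideal, and for $k\ge 1$ let $I_Z^{(k)}=\bigcap_{P\in Z}I_P^{\,k}$ be the ideal of polynomials vanishing to order at least $k$ at every point of $Z$ (the $k$-th symbolic power of $I_Z=I_Z^{(1)}$). For a nonzero homogeneous ideal $I$ put $\alpha(I)=\min\{j : [I]_j\ne 0\}$, and let $$\widehat\alpha(I_Z)=\lim_{k\to\infty}\frac{\alpha(I_Z^{(k)})}{k}$$ be the Waldschmidt constant of $I_Z$. The limit exists in both cases below, and one has: (a) If $|Z|=n+2$ and $t$ is the least integer such that some subset of $t+2$ points of $Z$ is linearly dependent, then $$\widehat\alpha(I_Z)=\frac{2n+2-t}{2n-t}.$$ (b) If $|Z|=n+3$ and $Z$ is in linearly general position (that is, any at most $n+1$ points of $Z$ are linearly independent), then $$\widehat\alpha(I_Z)=\begin{cases}\dfrac{n+2}{n} & \text{if } n \text{ is even},\\[2ex] \dfrac{(n+1)(n+3)}{n^2+2n-1} &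 \text{if } n \text{ is odd.}\end{cases}$$ -/

import Mathlib

open Filter Topology

noncomputable section

namespace FatPoints

variable {K : Type*} [Field K] {n : ℕ}

/-- Projective `n`-space over `K`: the `K`-rational points `(a₀ : … : aₙ)`. -/
abbrev ProjSpace (K : Type*) [Field K] (n : ℕ) : Type _ :=
  Projectivization K (Fin (n + 1) → K)

/-- The homogeneous ideal `I_P ⊆ K[x₀, …, xₙ]` of a point `P`, generated by the forms that vanish
at `P` (for a form, this does not depend on the chosen representative of `P`). -/
def pointIdeal (P : ProjSpace K n) : Ideal (MvPolynomial (Fin (n + 1)) K) :=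
  Ideal.span {F | (∃ d : ℕ, F.IsHomogeneous d) ∧ MvPolynomial.eval P.rep F = 0}

/-- The `k`-th symbolic power `I_Z^(k)` of the ideal of a finite set of points `Z`: the ideal
of the polynomials vanishing to order (at least) `k` at every point of `Z`, that is, the
intersection of the powers `I_P ^ k`, `P ∈ Z`. In particular `I_Z = I_Z^(1)`. -/
def symbolicPower (Z : Finset (ProjSpace K n)) (k : ℕ) :
    Ideal (MvPolynomial (Fin (n + 1)) K) :=
  ⨅ P ∈ Z, pointIdeal P ^ k

/-- The initial degree `α(I)` of a nonzero homogeneous ideal `I`: the least `j` with `[I]_j ≠ 0`.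
(The junk value for an ideal without nonzero forms is `0`.) -/
def initialDegree (I : Ideal (MvPolynomial (Fin (n + 1)) K)) : ℕ :=
  sInf {j : ℕ | ∃ F ∈ I, F.IsHomogeneous j ∧ F ≠ 0}

/-- The Waldschmidt constant of `I_Z` is `c`: the limit of `α(I_Z^(k)) / k` for `k → ∞` exists
and equals `c`. -/
def HasWaldschmidtConstant (Z : Finset (ProjSpace K n)) (c : ℝ) : Prop :=
  Tendsto (fun k : ℕ => (initialDegree (symbolicPower Z k) : ℝ) / (k : ℝ)) atTop (𝓝 c)

/-- The points of `Z` are linearly independent (their representing vectors are). -/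
def LinIndep (Z : Finset (ProjSpace K n)) : Prop :=
  Projectivization.Independent (fun P : Z => (P : ProjSpace K n))

/-- `Z` spans `ℙⁿ`: the lines of `K^(n+1)` that correspond to the points of `Z` span `K^(n+1)`. -/
def Spanning (Z : Finset (ProjSpace K n)) : Prop :=
  ⨆ P ∈ Z, P.submodule = ⊤

/-- `Z` is in linearly general position: any at most `n + 1` points of `Z` are linearly
independent, i.e. any `r + 1 ≤ n + 1` of them span an `r`-dimensional linear subspace. -/
def LinearlyGeneralPosition (Z : Finset (ProjSpace K n)) : Prop :=
  ∀ S ⊆ Z, S.card ≤ n + 1 → LinIndep S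

/-- `t` is the least integer such that some subset of `t + 2` points of `Z` is linearly dependent
(subsets with at most one point are independent, so `t` may be taken to be natural). -/
def IsDependencyIndex (Z : Finset (ProjSpace K n)) (t : ℕ) : Prop :=
  IsLeast {t : ℕ | ∃ S ⊆ Z, S.card = t + 2 ∧ ¬ LinIndep S} t

end FatPoints

end

/-! The constant is `D / M` once two facts are known: `D * k ≤ M * d` for every nonzero form of
degree `d` in `I_Z^(k)`, and some nonzero form of degree `D` lies in `I_Z^(M)`. Powers of the latter
then squeeze the quotients (`hasWaldschmidtConstant_of_extremal`).

Lower bounds come from inverting coordinates. If a form vanishes to order `k` at the coordinate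
points, its exponents are at most `d - k`, so an inversion followed by clearing denominators gives a
polynomial of small degree that keeps its order of vanishing where the inverted coordinates are
nonzero. For `n + 2` points, only the coordinates in the support of the extra point are inverted;
comparing order with degree gives (a), and also (b) for even `n`, where `n + 2` of the points
already give the sharp bound (`degree_bound_at_points`). For `n = 2 * m + 1` the `n + 3` points are
grouped into `m + 2` pairs. The Cremona map based at the complement of a pair can be normalised to
exchange that pair, so the configuration is unchanged and the maps can be iterated. Each changes the
degree by the same amount, and the final degree must be nonnegative (`degree_bound_of_odd`).

Upper bounds are explicit. In (a) the form is a product of hyperplanes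
(`exists_hyperplane_product`). In (b) with `n = 2 * m` it is a Hankel determinant of degree `m + 1`
with multiplicity `m` at all the points: the equation of a secant variety of a rational normal curve
through them. For odd `n` it is the product of the analogous cones, one with apex at each point
(`exists_secant_form_odd`).

Orders of vanishing are tested on arcs over the algebraic closure for the lower bounds, while the
extremal forms are placed directly in powers of point ideals over `K`. -/

namespace FatPoints

/-! ### Orders of vanishing along polynomial arcs. -/

/-- `F` vanishes to order at least `k` at the vector `v`, tested along polynomial arcs: for every
polynomial arc through `v` at time zero, the pullback of `F` is divisible by the `k`-th power of
the time variable. -/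
def VanishesToOrder {L σ : Type*} [Field L] (F : MvPolynomial σ L) (v : σ → L) (k : ℕ) : Prop :=
  ∀ γ : σ → Polynomial L, (∀ i, (γ i).eval 0 = v i) →
    Polynomial.X ^ k ∣ MvPolynomial.aeval γ F

theorem eval_aeval_arc {L σ : Type*} [Field L] (γ : σ → Polynomial L) (F : MvPolynomial σ L)
    (a : L) : (MvPolynomial.aeval γ F).eval a = MvPolynomial.eval (fun i => (γ i).eval a) F := by
  induction F using MvPolynomial.induction_on with
  | C r => simp
  | add p q hp hq => simp [hp, hq]
  | mul_X p i hp => simp [hp]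

theorem aeval_eq_sum_support {R A σ : Type*} [CommSemiring R] [CommSemiring A] [Algebra R A]
    [Fintype σ] (F : MvPolynomial σ R) (γ : σ → A) :
    MvPolynomial.aeval γ F =
      ∑ a ∈ F.support, algebraMap R A (F.coeff a) * ∏ i, γ i ^ a i := by
  rw [MvPolynomial.aeval_def, MvPolynomial.eval₂_eq']

theorem sum_exponent {R σ : Type*} [CommSemiring R] [Fintype σ] {F : MvPolynomial σ R} {d : ℕ}
    (hF : F.IsHomogeneous d) {a : σ →₀ ℕ} (ha : a ∈ F.support) : ∑ i, a i = d := by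
  rw [← hF (MvPolynomial.mem_support_iff.1 ha), Finsupp.weight_apply, Finsupp.sum_fintype] <;> simp

theorem exists_eval_ne_zero {L σ : Type*} [Field L] [Infinite L] {F : MvPolynomial σ L}
    (hF : F ≠ 0) : ∃ w, MvPolynomial.eval w F ≠ 0 := by
  by_contra! h
  exact hF (MvPolynomial.funext fun w => by simp [h w])

/-- Membership in a power of the ideal of a point implies vanishing to that order, also after an
extension of the base field. -/
theorem vanishesToOrder_of_mem_pow {K L : Type*} [Field K] [Field L] [Algebra K L] {n : ℕ}
    {P : ProjSpace K n} {k : ℕ} {F : MvPolynomial (Fin (n + 1)) K} (hF : F ∈ pointIdeal P ^ k) :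
    VanishesToOrder (MvPolynomial.map (algebraMap K L) F)
      (fun i => algebraMap K L (P.rep i)) k := by
  intro γ hγ
  rw [MvPolynomial.aeval_map_algebraMap]
  have hle : pointIdeal P ≤ Ideal.comap (MvPolynomial.aeval (R := K) γ)
      (Ideal.span {(Polynomial.X : Polynomial L)}) := by
    rw [pointIdeal, Ideal.span_le]
    rintro G ⟨-, hG⟩
    rw [SetLike.mem_coe, Ideal.mem_comap, Ideal.mem_span_singleton, Polynomial.X_dvd_iff,
      Polynomial.coeff_zero_eq_eval_zero, ← MvPolynomial.aeval_map_algebraMap L, eval_aeval_arc]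
    simp only [hγ]
    rw [MvPolynomial.eval_map, ← MvPolynomial.aeval_def,
      show (fun i => algebraMap K L (P.rep i)) = algebraMap K L ∘ P.rep from rfl,
      MvPolynomial.aeval_algebraMap_apply]
    have h0 : MvPolynomial.aeval P.rep G = 0 := hG
    rw [h0, map_zero]
  have h := Ideal.pow_right_mono hle k hF
  have h2 := Ideal.le_comap_pow _ _ h
  rw [Ideal.mem_comap, Ideal.span_singleton_pow, Ideal.mem_span_singleton] at h2
  exact h2

/-- The vanishing order of a nonzero polynomial is at most its degree. -/
theorem VanishesToOrder.le_of_degree_le {L σ : Type*} [Field L] [Infinite L] [Fintype σ]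
    {G : MvPolynomial σ L} {v : σ → L} {k D : ℕ} (h : VanishesToOrder G v k) (hG : G ≠ 0)
    (hD : ∀ a ∈ G.support, ∑ i, a i ≤ D) : k ≤ D := by
  -- Restricted to the line from `v` (time 0) to `w` (time 1), `G` is a nonzero univariate
  -- polynomial of degree at most `D`, divisible by `X ^ k`.
  obtain ⟨w, hw⟩ := exists_eval_ne_zero hG
  set γ : σ → Polynomial L := fun i => Polynomial.C (v i) + Polynomial.C (w i - v i) * Polynomial.X
  have hdvd := h γ (fun i => by simp [γ])
  have hne : MvPolynomial.aeval γ G ≠ 0 := by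
    intro h0
    have := eval_aeval_arc γ G 1
    rw [h0] at this
    simp only [γ, Polynomial.eval_zero, Polynomial.eval_add, Polynomial.eval_mul,
      Polynomial.eval_C, Polynomial.eval_X, mul_one, add_sub_cancel] at this
    exact hw this.symm
  have hdeg : (MvPolynomial.aeval γ G).natDegree ≤ D := by
    rw [aeval_eq_sum_support]
    refine Polynomial.natDegree_sum_le_of_forall_le _ _ fun a ha => ?_
    refine (Polynomial.natDegree_C_mul_le _ _).trans ?_
    refine (Polynomial.natDegree_prod_le _ _).trans ((Finset.sum_le_sum fun i _ => ?_).trans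
      (hD a ha))
    refine Polynomial.natDegree_pow_le.trans ?_
    have : (γ i).natDegree ≤ 1 := by simp only [γ]; compute_degree
    nlinarith
  have := Polynomial.natDegree_le_of_dvd hdvd hne
  rw [Polynomial.natDegree_X_pow] at this
  exact this.trans hdeg

/-- The order of vanishing of a form is insensitive to rescaling the vector. -/
theorem VanishesToOrder.of_smul {L σ : Type*} [Field L] [Fintype σ] {F : MvPolynomial σ L}
    {d : ℕ} (hF : F.IsHomogeneous d) {v : σ → L} {c : L} (hc : c ≠ 0) {k : ℕ}
    (h : VanishesToOrder F (c • v) k) : VanishesToOrder F v k := by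
  intro γ hγ
  have h1 := h (fun i => Polynomial.C c * γ i) (fun i => by simp [hγ])
  have h2 : MvPolynomial.aeval (fun i => Polynomial.C c * γ i) F =
      Polynomial.C (c ^ d) * MvPolynomial.aeval γ F := by
    rw [aeval_eq_sum_support, aeval_eq_sum_support, Finset.mul_sum]
    refine Finset.sum_congr rfl fun a ha => ?_
    simp only [mul_pow, Finset.prod_mul_distrib, Finset.prod_pow_eq_pow_sum, sum_exponent hF ha,
      Polynomial.C_pow]
    ring
  rw [h2] at h1
  have hu : IsUnit (Polynomial.C (c ^ d)) := Polynomial.isUnit_C.2 (isUnit_iff_ne_zero.2 (by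
    exact pow_ne_zero _ hc))
  exact hu.dvd_mul_left.1 h1

/-- A form vanishing to order `k` at a coordinate point has bounded degree in that coordinate. -/
theorem VanishesToOrder.exponent_add_le {L σ : Type*} [Field L] [Infinite L] [Fintype σ]
    [DecidableEq σ] {F : MvPolynomial σ L} {d : ℕ} (hF : F.IsHomogeneous d) {i : σ} {k : ℕ}
    (h : VanishesToOrder F (Pi.single i 1) k) {a : σ →₀ ℕ} (ha : a ∈ F.support) :
    a i + k ≤ d := by
  by_contra! hlt
  have hai : a i ≤ d := by
    rw [← sum_exponent hF ha]
    exact Finset.single_le_sum (f := fun i => a i) (fun _ _ => Nat.zero_le _) (Finset.mem_univ i)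
  -- Along the arcs with `i`-th coordinate 1 and the others `w j * X`, the coefficient of `X ^ r`
  -- collects exactly the terms of `F` with exponent `a i` at `i`. It vanishes since `r < k`, so
  -- `H`, the sum of these terms, is zero.
  set r := d - a i with hr
  set H : MvPolynomial σ L :=
    ∑ b ∈ F.support with b i = a i, MvPolynomial.monomial b (F.coeff b) with hH
  have hH0 : H = 0 := by
    refine MvPolynomial.funext fun w => ?_
    set γ : σ → Polynomial L := fun j => if j = i then 1 else Polynomial.C (w j) * Polynomial.X
      with hγ
    have hdvd := h γ (fun j => by
      by_cases hj : j = i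
      · subst hj; simp [γ]
      · simp [γ, hj])
    have hcoeff := (Polynomial.X_pow_dvd_iff.1 hdvd) r (by omega)
    have hprod : ∀ b ∈ F.support, ∏ j, γ j ^ b j =
        Polynomial.C (∏ j ∈ Finset.univ.erase i, w j ^ b j) * Polynomial.X ^ (d - b i) := by
      intro b hb
      rw [← Finset.mul_prod_erase _ _ (Finset.mem_univ i)]
      have : ∀ j ∈ Finset.univ.erase i, γ j ^ b j =
          Polynomial.C (w j ^ b j) * Polynomial.X ^ b j := by
        intro j hj
        simp [γ, Finset.ne_of_mem_erase hj, mul_pow]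
      rw [Finset.prod_congr rfl this, Finset.prod_mul_distrib, Finset.prod_pow_eq_pow_sum]
      have hs := Finset.add_sum_erase Finset.univ (fun j => b j) (Finset.mem_univ i)
      rw [sum_exponent hF hb] at hs
      rw [show ∑ j ∈ Finset.univ.erase i, b j = d - b i by omega]
      simp [γ, map_prod]
    rw [aeval_eq_sum_support, Polynomial.finsetSum_coeff] at hcoeff
    rw [hH, map_sum, map_zero]
    have hterm : ∀ b ∈ F.support, (algebraMap L (Polynomial L) (F.coeff b) *
        ∏ j, γ j ^ b j).coeff r = if b i = a i then
          F.coeff b * ∏ j ∈ Finset.univ.erase i, w j ^ b j else 0 := by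
      intro b hb
      have hbi : b i ≤ d := by
        rw [← sum_exponent hF hb]
        exact Finset.single_le_sum (f := fun i => b i) (fun _ _ => Nat.zero_le _)
          (Finset.mem_univ i)
      rw [hprod b hb, Polynomial.algebraMap_eq, Polynomial.coeff_C_mul, Polynomial.coeff_C_mul,
        Polynomial.coeff_X_pow]
      by_cases hb2 : b i = a i
      · simp [hb2, hr]
      · rw [if_neg (by omega), if_neg hb2]; simp
    rw [Finset.sum_congr rfl hterm, ← Finset.sum_filter] at hcoeff
    have : ∀ b ∈ F.support.filter (fun b => b i = a i),
        MvPolynomial.eval w (MvPolynomial.monomial b (F.coeff b)) =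
        w i ^ a i * (F.coeff b * ∏ j ∈ Finset.univ.erase i, w j ^ b j) := by
      intro b hb
      rw [MvPolynomial.eval_monomial, Finsupp.prod_pow,
        ← Finset.mul_prod_erase _ _ (Finset.mem_univ i), (Finset.mem_filter.1 hb).2]
      ring
    rw [Finset.sum_congr rfl this, ← Finset.mul_sum, hcoeff, mul_zero]
  have hc : H.coeff a = F.coeff a := by
    rw [hH, MvPolynomial.coeff_sum]
    simp only [MvPolynomial.coeff_monomial]
    rw [Finset.sum_ite_eq' , if_pos (by simpa using ha)]
  rw [hH0, MvPolynomial.coeff_zero] at hc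
  exact MvPolynomial.mem_support_iff.1 ha hc.symm

/-- A form of small degree in one coordinate vanishes to high order at that coordinate point. -/
theorem vanishesToOrder_single {L σ : Type*} [Field L] [Fintype σ] [DecidableEq σ]
    {F : MvPolynomial σ L} {d : ℕ} (hF : F.IsHomogeneous d) {i : σ} {k : ℕ}
    (h : ∀ a ∈ F.support, a i + k ≤ d) : VanishesToOrder F (Pi.single i 1) k := by
  intro γ hγ
  rw [aeval_eq_sum_support]
  refine Finset.dvd_sum fun a ha => Dvd.dvd.mul_left ?_ _
  rw [← Finset.mul_prod_erase _ _ (Finset.mem_univ i)]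
  refine Dvd.dvd.mul_left ?_ _
  have hs := Finset.add_sum_erase Finset.univ (fun j => a j) (Finset.mem_univ i)
  rw [sum_exponent hF ha] at hs
  have hk := h a ha
  refine (pow_dvd_pow _ (show k ≤ ∑ j ∈ Finset.univ.erase i, a j by omega)).trans ?_
  rw [← Finset.prod_pow_eq_pow_sum]
  refine Finset.prod_dvd_prod_of_dvd _ _ fun j hj => pow_dvd_pow_of_dvd ?_ _
  rw [Polynomial.X_dvd_iff, Polynomial.coeff_zero_eq_eval_zero, hγ,
    Pi.single_eq_of_ne (Finset.ne_of_mem_erase hj)]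

/-! ### Inversion of a set of coordinates and its effect on forms. -/

section Cremona

variable {L σ : Type*} [Field L] [Fintype σ] [DecidableEq σ]

/-- The exponents of the transform of a monomial under inversion of the coordinates in `S`. -/
noncomputable def cremonaExponent (S : Finset σ) (d : ℤ) (k : σ → ℤ) (a : σ →₀ ℕ) : σ →₀ ℕ :=
  Finsupp.equivFunOnFinite.symm fun i => if i ∈ S then (d - k i - a i).toNat else a i

/-- The transform of a form `F` of degree `d` under the inversion `xᵢ ↦ cᵢ / xᵢ` of the
coordinates `xᵢ`, `i ∈ S`, with denominators cleared by `∏ xᵢ ^ (d - kᵢ)`. -/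
noncomputable def cremona (S : Finset σ) (d : ℤ) (k : σ → ℤ) (c : σ → L)
    (F : MvPolynomial σ L) : MvPolynomial σ L :=
  ∑ a ∈ F.support,
    MvPolynomial.monomial (cremonaExponent S d k a) (F.coeff a * ∏ i ∈ S, c i ^ a i)

/-- The arc obtained from `γ` by the inversion of the coordinates in `S`, with denominators
cleared. -/
def cremonaArc {A : Type*} [CommRing A] [Algebra L A] (S : Finset σ) (c : σ → L) (γ : σ → A) :
    σ → A := fun i =>
  if i ∈ S then algebraMap L A (c i) * ∏ j ∈ S.erase i, γ j else γ i * ∏ j ∈ S, γ j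

theorem cremonaExponent_of_mem {S : Finset σ} {d : ℤ} {k : σ → ℤ} {a : σ →₀ ℕ} {i : σ}
    (hi : i ∈ S) (h : a i + k i ≤ d) : (cremonaExponent S d k a i : ℤ) = d - k i - a i := by
  simp only [cremonaExponent, Finsupp.equivFunOnFinite_symm_apply_apply, if_pos hi]
  omega

theorem cremonaExponent_of_notMem {S : Finset σ} {d : ℤ} {k : σ → ℤ} {a : σ →₀ ℕ} {i : σ}
    (hi : i ∉ S) : cremonaExponent S d k a i = a i := by
  simp only [cremonaExponent, Finsupp.equivFunOnFinite_symm_apply_apply, if_neg hi]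

variable {S : Finset σ} {d : ℤ} {k : σ → ℤ} {c : σ → L} {F : MvPolynomial σ L}

theorem exists_of_mem_support_cremona {b : σ →₀ ℕ} (hb : b ∈ (cremona S d k c F).support) :
    ∃ a ∈ F.support, b = cremonaExponent S d k a := by
  by_contra! h
  refine MvPolynomial.mem_support_iff.1 hb ?_
  rw [cremona, MvPolynomial.coeff_sum]
  refine Finset.sum_eq_zero fun a ha => ?_
  rw [MvPolynomial.coeff_monomial, if_neg (h a ha).symm]

/-- On the support of `F` no truncation occurs in `cremonaExponent`, which is therefore injective
there: distinct monomials cannot cancel. -/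
theorem cremona_ne_zero (hk : ∀ a ∈ F.support, ∀ i ∈ S, a i + k i ≤ d) (hc : ∀ i ∈ S, c i ≠ 0)
    (hF : F ≠ 0) : cremona S d k c F ≠ 0 := by
  obtain ⟨a, ha⟩ := Finset.nonempty_iff_ne_empty.2 (mt MvPolynomial.support_eq_empty.1 hF)
  intro h0
  have h1 := congrArg (MvPolynomial.coeff (cremonaExponent S d k a)) h0
  rw [cremona, MvPolynomial.coeff_sum, Finset.sum_eq_single a, MvPolynomial.coeff_monomial,
    if_pos rfl, MvPolynomial.coeff_zero] at h1
  · exact mul_ne_zero (MvPolynomial.mem_support_iff.1 ha)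
      (Finset.prod_ne_zero_iff.2 fun i hi => pow_ne_zero _ (hc i hi)) h1
  · intro b hb hba
    rw [MvPolynomial.coeff_monomial, if_neg]
    intro heq
    refine hba (Finsupp.ext fun i => ?_)
    have hi := DFunLike.congr_fun heq i
    by_cases hiS : i ∈ S
    · have h2 := cremonaExponent_of_mem hiS (hk a ha i hiS)
      have h3 := cremonaExponent_of_mem hiS (hk b hb i hiS)
      omega
    · rwa [cremonaExponent_of_notMem hiS, cremonaExponent_of_notMem hiS] at hi
  · exact fun h => absurd ha h

theorem sum_cremonaExponent {a : σ →₀ ℕ} (hk : ∀ i ∈ S, a i + k i ≤ d) :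
    ((∑ i, cremonaExponent S d k a i : ℕ) : ℤ) =
      S.card * d - ∑ i ∈ S, k i - ∑ i ∈ S, (a i : ℤ) + ∑ i ∈ Sᶜ, (a i : ℤ) := by
  push_cast
  rw [← Finset.sum_add_sum_compl S, Finset.sum_congr rfl fun i hi =>
    cremonaExponent_of_mem hi (hk i hi), Finset.sum_sub_distrib, Finset.sum_sub_distrib,
    Finset.sum_const, nsmul_eq_mul]
  congr 1
  refine Finset.sum_congr rfl fun i hi => ?_
  rw [cremonaExponent_of_notMem (Finset.mem_compl.1 hi)]

theorem isHomogeneous_cremona_univ {d : ℕ} {F : MvPolynomial σ L} (hF : F.IsHomogeneous d)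
    {e : ℕ} (he : (e : ℤ) = (Fintype.card σ - 1) * d - ∑ i, k i)
    (hk : ∀ a ∈ F.support, ∀ i, a i + k i ≤ d) :
    (cremona Finset.univ d k c F).IsHomogeneous e := by
  intro b hb
  obtain ⟨a, ha, rfl⟩ := exists_of_mem_support_cremona (MvPolynomial.mem_support_iff.2 hb)
  rw [Finsupp.weight_apply, Finsupp.sum_fintype _ _ (by simp)]
  have h1 := sum_cremonaExponent (S := Finset.univ) (d := d) (fun i _ => hk a ha i)
  have h2 : (∑ i, (a i : ℤ)) = d := by exact_mod_cast sum_exponent hF ha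
  simp only [Finset.compl_univ, Finset.sum_empty, h2, Finset.card_univ] at h1
  simp only [Pi.one_apply, smul_eq_mul, mul_one]
  zify
  push_cast at h1
  rw [h1, he]
  ring

/-- For `i ∈ S`, the factor `γ i` enters every coordinate of the inverted arc except the `i`-th,
whence the exponent omitting `a i`. -/
theorem prod_cremonaArc_pow {A : Type*} [CommRing A] [Algebra L A] (γ : σ → A) (a : σ →₀ ℕ) :
    ∏ i, cremonaArc S c γ i ^ a i =
      algebraMap L A (∏ i ∈ S, c i ^ a i) *
        ((∏ i ∈ S, γ i ^ (∑ j ∈ Finset.univ.erase i, a j)) * ∏ i ∈ Sᶜ, γ i ^ a i) := by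
  rw [← Finset.prod_mul_prod_compl S]
  have h1 : ∀ i ∈ S, cremonaArc S c γ i ^ a i =
      algebraMap L A (c i ^ a i) * ∏ j ∈ S.erase i, γ j ^ a i := by
    intro i hi
    simp only [cremonaArc, if_pos hi, mul_pow, map_pow, Finset.prod_pow]
  have h2 : ∀ i ∈ Sᶜ, cremonaArc S c γ i ^ a i = γ i ^ a i * ∏ j ∈ S, γ j ^ a i := by
    intro i hi
    simp only [cremonaArc, if_neg (Finset.mem_compl.1 hi), mul_pow, Finset.prod_pow]
  rw [Finset.prod_congr rfl h1, Finset.prod_congr rfl h2, Finset.prod_mul_distrib,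
    Finset.prod_mul_distrib, map_prod, mul_assoc]
  congr 1
  have h3 : ∏ i ∈ S, ∏ j ∈ S.erase i, γ j ^ a i = ∏ j ∈ S, ∏ i ∈ S.erase j, γ j ^ a i :=
    Finset.prod_comm' (by
      intro x y
      simp only [Finset.mem_erase]
      tauto)
  have h4 : ∏ i ∈ Sᶜ, ∏ j ∈ S, γ j ^ a i = ∏ j ∈ S, ∏ i ∈ Sᶜ, γ j ^ a i := Finset.prod_comm
  rw [h3, h4, mul_left_comm, mul_comm, ← Finset.prod_mul_distrib]
  congr 1
  refine Finset.prod_congr rfl fun j hj => ?_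
  rw [Finset.prod_pow_eq_pow_sum, Finset.prod_pow_eq_pow_sum, ← pow_add]
  congr 1
  have hs := Finset.sum_add_sum_compl S (fun i => a i)
  have h5 := Finset.add_sum_erase S (fun i => a i) hj
  have h6 := Finset.add_sum_erase Finset.univ (fun i => a i) (Finset.mem_univ j)
  omega

/-- The functional equation relating a form and its transform. -/
theorem aeval_cremonaArc_mul {A : Type*} [CommRing A] [Algebra L A] {d : ℕ}
    (hF : F.IsHomogeneous d) (hk : ∀ a ∈ F.support, ∀ i ∈ S, a i + k i ≤ d) (γ : σ → A) :
    MvPolynomial.aeval (cremonaArc S c γ) F * ∏ i ∈ S, γ i ^ (-k i).toNat =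
      MvPolynomial.aeval γ (cremona S d k c F) * ∏ i ∈ S, γ i ^ (k i).toNat := by
  rw [aeval_eq_sum_support, cremona, map_sum, Finset.sum_mul, Finset.sum_mul]
  refine Finset.sum_congr rfl fun a ha => ?_
  rw [prod_cremonaArc_pow, MvPolynomial.aeval_monomial, Finsupp.prod_pow,
    ← Finset.prod_mul_prod_compl S (fun i => γ i ^ cremonaExponent S d k a i), map_mul]
  have h1 : ∏ i ∈ Sᶜ, γ i ^ cremonaExponent S d k a i = ∏ i ∈ Sᶜ, γ i ^ a i :=
    Finset.prod_congr rfl fun i hi => by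
      rw [cremonaExponent_of_notMem (Finset.mem_compl.1 hi)]
  have h2 : (∏ i ∈ S, γ i ^ (∑ j ∈ Finset.univ.erase i, a j)) * ∏ i ∈ S, γ i ^ (-k i).toNat =
      (∏ i ∈ S, γ i ^ cremonaExponent S d k a i) * ∏ i ∈ S, γ i ^ (k i).toNat := by
    rw [← Finset.prod_mul_distrib, ← Finset.prod_mul_distrib]
    refine Finset.prod_congr rfl fun i hi => ?_
    rw [← pow_add, ← pow_add]
    congr 1
    have h3 := cremonaExponent_of_mem hi (hk a ha i hi)
    have h4 := Finset.add_sum_erase Finset.univ (fun i => a i) (Finset.mem_univ i)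
    rw [sum_exponent hF ha] at h4
    have := hk a ha i hi
    omega
  rw [h1]
  linear_combination (algebraMap L A (F.coeff a) * algebraMap L A (∏ i ∈ S, c i ^ a i) *
    ∏ i ∈ Sᶜ, γ i ^ a i) * h2

/-- Inversion preserves the order of vanishing at a point whose inverted coordinates are nonzero. -/
theorem VanishesToOrder.cremona {d : ℕ} (hF : F.IsHomogeneous d)
    (hk : ∀ a ∈ F.support, ∀ i ∈ S, a i + k i ≤ d) {v : σ → L} (hv : ∀ i ∈ S, v i ≠ 0) {m : ℕ}
    (h : VanishesToOrder F (cremonaArc S c v) m) :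
    VanishesToOrder (cremona S d k c F) v m := by
  intro γ hγ
  have h1 := h (cremonaArc S c γ) (fun i => by
    by_cases hi : i ∈ S
    · simp [cremonaArc, hi, Polynomial.eval_prod, hγ]
    · simp [cremonaArc, hi, Polynomial.eval_prod, hγ])
  have h2 := (Dvd.dvd.mul_right h1 (∏ i ∈ S, γ i ^ (-k i).toNat))
  rw [aeval_cremonaArc_mul hF hk] at h2
  -- The extra factors are powers of `γ i` with `i ∈ S`, nonzero at time 0, so the prime `X` does
  -- not divide them.
  refine Polynomial.prime_X.pow_dvd_of_dvd_mul_right _ ?_ h2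
  rw [Polynomial.X_dvd_iff, Polynomial.coeff_zero_eq_eval_zero, Polynomial.eval_prod]
  exact Finset.prod_ne_zero_iff.2 fun i hi => by
    rw [Polynomial.eval_pow, hγ]
    exact pow_ne_zero _ (hv i hi)

end Cremona

/-! ### The degree bound from one inversion. -/

/-- The degree bound for a form vanishing to order `k` at all coordinate points and at one more
point, in terms of the support of the latter. -/
theorem degree_bound_of_circuit {L σ : Type*} [Field L] [Infinite L] [Fintype σ] [DecidableEq σ]
    {F : MvPolynomial σ L} {d k : ℕ} (hF : F.IsHomogeneous d) (hF0 : F ≠ 0)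
    (h : ∀ i, VanishesToOrder F (Pi.single i 1) k) {c : σ → L} {S : Finset σ}
    (hS : ∀ i, i ∈ S ↔ c i ≠ 0) (hc : VanishesToOrder F c k) :
    (k : ℤ) ≤ S.card * (d - k) - d + 2 * Sᶜ.card * (d - k) := by
  have hk : ∀ a ∈ F.support, ∀ i, (a i : ℤ) + k ≤ d := fun a ha i => by
    exact_mod_cast (h i).exponent_add_le hF ha
  have hG0 := cremona_ne_zero (S := S) (k := fun _ => (k : ℤ)) (c := c)
    (fun a ha i _ => hk a ha i) (fun i hi => (hS i).1 hi) hF0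
  -- With constants `c`, the indicator vector of `S` is sent to `c`: off `S` both vectors are zero.
  have hG := VanishesToOrder.cremona (S := S) (k := fun _ => (k : ℤ)) (c := c) (m := k) hF
    (fun a ha i _ => hk a ha i) (v := fun i => if i ∈ S then 1 else 0)
    (fun i hi => by simp [hi]) (by
      convert hc using 1
      funext i
      by_cases hi : i ∈ S
      · simp only [cremonaArc, hi, if_true, Algebra.algebraMap_self, RingHom.id_apply]
        rw [Finset.prod_eq_one fun j hj => if_pos (Finset.mem_of_mem_erase hj), mul_one]
      · have : c i = 0 := by_contra fun h0 => hi ((hS i).2 h0)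
        simp [cremonaArc, hi, this])
  -- For `S` not everything the transform need not be homogeneous; the exponents outside `S`, each
  -- at most `d - k`, account for the coefficient 2.
  have hsum : ∀ b ∈ (FatPoints.cremona S d (fun _ => (k : ℤ)) c F).support,
      ((∑ i, b i : ℕ) : ℤ) ≤ S.card * (d - k) - d + 2 * Sᶜ.card * (d - k) := by
    intro b hb
    obtain ⟨a, ha, rfl⟩ := exists_of_mem_support_cremona hb
    rw [sum_cremonaExponent (fun i _ => hk a ha i)]
    have h1 : (∑ i ∈ S, (a i : ℤ)) + ∑ i ∈ Sᶜ, (a i : ℤ) = d := by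
      rw [Finset.sum_add_sum_compl]
      exact_mod_cast sum_exponent hF ha
    have h2 : ∑ i ∈ Sᶜ, (a i : ℤ) ≤ ∑ i ∈ Sᶜ, ((d : ℤ) - k) :=
      Finset.sum_le_sum fun i _ => by linarith [hk a ha i]
    rw [Finset.sum_const, nsmul_eq_mul] at h2
    rw [Finset.sum_const, nsmul_eq_mul]
    linarith
  obtain ⟨b, hb⟩ := Finset.nonempty_iff_ne_empty.2 (mt MvPolynomial.support_eq_empty.1 hG0)
  have hpos := (Int.natCast_nonneg _).trans (hsum b hb)
  have := hG.le_of_degree_le hG0 (D := (S.card * ((d : ℤ) - k) - d + 2 * Sᶜ.card * (d - k)).toNat)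
    (fun b hb => by have := hsum b hb; omega)
  omega

/-! ### Linear changes of coordinates, acting on row vectors. -/

section LinearSubstitution

variable {L σ : Type*} [Field L] [Fintype σ]

/-- The form `w ↦ F (w A)`. -/
noncomputable def linSubst (A : Matrix σ σ L) (F : MvPolynomial σ L) : MvPolynomial σ L :=
  MvPolynomial.aeval (fun j => ∑ i, MvPolynomial.C (A i j) * MvPolynomial.X i) F

theorem aeval_linSubst {B : Type*} [CommRing B] [Algebra L B] (A : Matrix σ σ L)
    (F : MvPolynomial σ L) (γ : σ → B) :
    MvPolynomial.aeval γ (linSubst A F) =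
      MvPolynomial.aeval (fun j => ∑ i, algebraMap L B (A i j) * γ i) F := by
  rw [linSubst, ← AlgHom.comp_apply, MvPolynomial.comp_aeval]
  simp [MvPolynomial.algHom_C]

theorem linSubst_linSubst (A B : Matrix σ σ L) (F : MvPolynomial σ L) :
    linSubst B (linSubst A F) = linSubst (B * A) F := by
  refine (aeval_linSubst A F _).trans ?_
  have h : (fun j => ∑ i, algebraMap L (MvPolynomial σ L) (A i j) *
      ∑ l, MvPolynomial.C (B l i) * MvPolynomial.X l) =
      fun j => ∑ l, MvPolynomial.C ((B * A) l j) * (MvPolynomial.X l : MvPolynomial σ L) := by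
    funext j
    simp only [Matrix.mul_apply, MvPolynomial.algebraMap_eq, map_sum, map_mul, Finset.sum_mul,
      Finset.mul_sum]
    rw [Finset.sum_comm]
    exact Finset.sum_congr rfl fun _ _ => Finset.sum_congr rfl fun _ _ => by ring
  rw [h, linSubst]

theorem linSubst_one [DecidableEq σ] (F : MvPolynomial σ L) : linSubst 1 F = F := by
  have : (fun j : σ => ∑ i, MvPolynomial.C ((1 : Matrix σ σ L) i j) * MvPolynomial.X i) =
      (MvPolynomial.X : σ → MvPolynomial σ L) := by
    funext j
    rw [Finset.sum_eq_single j] <;> simp +contextual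
  rw [linSubst, this, MvPolynomial.aeval_X_left, AlgHom.id_apply]

theorem linSubst_ne_zero [DecidableEq σ] {A : Matrix σ σ L} (hA : IsUnit A.det) {F : MvPolynomial σ L}
    (hF : F ≠ 0) : linSubst A F ≠ 0 := by
  intro h
  apply hF
  rw [← linSubst_one F, ← Matrix.nonsing_inv_mul A hA, ← linSubst_linSubst, h, linSubst, map_zero]

theorem isHomogeneous_linSubst (A : Matrix σ σ L) {F : MvPolynomial σ L} {d : ℕ}
    (hF : F.IsHomogeneous d) : (linSubst A F).IsHomogeneous d := by
  have := hF.aeval (n := 1) (fun j => ∑ i, MvPolynomial.C (A i j) * MvPolynomial.X i) (fun j =>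
    MvPolynomial.IsHomogeneous.sum _ _ _ fun i _ => by
      simpa using (MvPolynomial.isHomogeneous_C σ (A i j)).mul (MvPolynomial.isHomogeneous_X L i))
  simpa [linSubst] using this

theorem VanishesToOrder.linSubst {A : Matrix σ σ L} {F : MvPolynomial σ L} {v : σ → L} {k : ℕ}
    (h : VanishesToOrder F (Matrix.vecMul v A) k) : VanishesToOrder (linSubst A F) v k := by
  intro γ hγ
  rw [aeval_linSubst]
  refine h _ fun j => ?_
  rw [Polynomial.eval_finsetSum]
  simp [hγ, Matrix.vecMul, dotProduct, mul_comm]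

theorem VanishesToOrder.linSubst_inv [DecidableEq σ] {A : Matrix σ σ L} (hA : IsUnit A.det)
    {G : MvPolynomial σ L} {v : σ → L} {k : ℕ} (h : VanishesToOrder G v k) :
    VanishesToOrder (FatPoints.linSubst A⁻¹ G) (Matrix.vecMul v A) k := by
  refine VanishesToOrder.linSubst ?_
  rwa [Matrix.vecMul_vecMul, Matrix.mul_nonsing_inv A hA, Matrix.vecMul_one]

end LinearSubstitution

/-! ### Iterated Cremona transformations and the lower bound for odd `n`. -/

section CremonaStep

variable {L τ : Type*} [Field L] [Infinite L] {n : ℕ}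

/-- A family of vectors of `L^(n+1)`, any `n + 1` of which form a basis. -/
def InGeneralPosition {L τ : Type*} [Field L] {n : ℕ} (v : τ → Fin (n + 1) → L) : Prop :=
  ∀ e : Fin (n + 1) → τ, Function.Injective e → (Matrix.of (v ∘ e)).det ≠ 0

/-- Cramer's rule for row vectors: `Matrix.vecMul w A⁻¹` holds the coordinates of `w` in the basis
of the rows of `A`. -/
theorem det_update_row {L : Type*} [Field L] {n : ℕ} {A : Matrix (Fin (n + 1)) (Fin (n + 1)) L}
    (hA : A.det ≠ 0) (w : Fin (n + 1) → L) (i : Fin (n + 1)) :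
    (A.updateRow i w).det = Matrix.vecMul w A⁻¹ i * A.det := by
  have h := Matrix.det_updateRow_sum A i (Matrix.vecMul w A⁻¹)
  have h2 : ∑ k, Matrix.vecMul w A⁻¹ k • A k = w := by
    rw [← Matrix.vecMul_eq_sum, Matrix.vecMul_vecMul, Matrix.nonsing_inv_mul A hA.isUnit,
      Matrix.vecMul_one]
  rw [h2] at h
  exact h

/-- By Cramer's rule a zero coordinate would make the points `e j`, `j ≠ i`, together with `p`,
dependent. -/
theorem InGeneralPosition.coord_ne_zero {L τ : Type*} [Field L] {n : ℕ}
    {v : τ → Fin (n + 1) → L} (hv : InGeneralPosition v) {e : Fin (n + 1) → τ}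
    (he : Function.Injective e) {p : τ} (hp : ∀ i, e i ≠ p) (i : Fin (n + 1)) :
    Matrix.vecMul (v p) (Matrix.of (v ∘ e))⁻¹ i ≠ 0 := by
  classical
  intro h0
  have h := det_update_row (hv e he) (v p) i
  rw [h0, zero_mul] at h
  refine hv (Function.update e i p) ?_ ?_
  · intro a b hab
    by_cases ha : a = i <;> by_cases hb : b = i
    · rw [ha, hb]
    · subst ha; simp [hb] at hab; exact absurd hab.symm (hp b)
    · subst hb; simp [ha] at hab; exact absurd hab (hp a)
    · simp [ha, hb] at hab; exact he hab
  · rw [← h]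
    congr 1
    ext a b
    by_cases ha : a = i
    · subst ha; simp
    · simp [ha, Matrix.updateRow_ne]

theorem exists_enumeration_compl_pair [Fintype τ] [DecidableEq τ]
    (hτ : Fintype.card τ = n + 3) {p q : τ} (hpq : p ≠ q) :
    ∃ e : Fin (n + 1) → τ, Function.Injective e ∧ (∀ i, e i ≠ p) ∧ (∀ i, e i ≠ q) ∧
      (∀ x, x ≠ p → x ≠ q → ∃ i, e i = x) ∧
      ∀ f : τ → ℤ, ∑ i, f (e i) = ∑ x, f x - f p - f q := by
  set s : Finset τ := (Finset.univ.erase p).erase q with hs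
  have hq : q ∈ Finset.univ.erase p := by simp [hpq.symm]
  have hcard : s.card = n + 1 := by
    rw [hs, Finset.card_erase_of_mem hq, Finset.card_erase_of_mem (Finset.mem_univ p),
      Finset.card_univ, hτ]
    omega
  set E := (s.equivFinOfCardEq hcard).symm
  have hmem : ∀ i, (E i : τ) ≠ q ∧ (E i : τ) ≠ p := fun i => by
    have := Finset.mem_erase.1 (E i).2
    exact ⟨this.1, (Finset.mem_erase.1 this.2).1⟩
  refine ⟨fun i => E i, Subtype.val_injective.comp E.injective, fun i => (hmem i).2,
    fun i => (hmem i).1, fun x hxp hxq => ⟨E.symm ⟨x, by simp [hs, hxp, hxq]⟩, by simp⟩,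
    fun f => ?_⟩
  rw [Equiv.sum_comp E (fun x => f x), Finset.sum_coe_sort s f, hs,
    Finset.sum_erase_eq_sub hq, Finset.sum_erase_eq_sub (Finset.mem_univ p)]

/-- The Cremona transformation based at `n + 1` points, normalised so that it exchanges the two
remaining points `p` and `q` of a configuration in general position. -/
theorem exists_cremona_transform {v : τ → Fin (n + 1) → L} (hv : InGeneralPosition v)
    {e : Fin (n + 1) → τ} (he : Function.Injective e) {p q : τ} (hp : ∀ i, e i ≠ p)
    (hq : ∀ i, e i ≠ q) {F : MvPolynomial (Fin (n + 1)) L} {d : ℕ} (hF : F.IsHomogeneous d)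
    (hF0 : F ≠ 0) {κ : Fin (n + 1) → ℤ} {a b : ℕ}
    (hκ : ∀ i, VanishesToOrder F (v (e i)) (κ i).toNat) (hFp : VanishesToOrder F (v p) a)
    (hFq : VanishesToOrder F (v q) b) :
    ∃ (G : MvPolynomial (Fin (n + 1)) L) (d' : ℕ), G ≠ 0 ∧ G.IsHomogeneous d' ∧
      (d' : ℤ) = n * d - ∑ i, κ i ∧
      (∀ i, VanishesToOrder G (v (e i)) (κ i + d' - d).toNat) ∧
      VanishesToOrder G (v p) b ∧ VanishesToOrder G (v q) a := by
  set A := Matrix.of (v ∘ e) with hA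
  have hdet : IsUnit A.det := (hv e he).isUnit
  set α := Matrix.vecMul (v p) A⁻¹
  set β := Matrix.vecMul (v q) A⁻¹
  have hα : ∀ i, α i ≠ 0 := hv.coord_ne_zero he hp
  have hβ : ∀ i, β i ≠ 0 := hv.coord_ne_zero he hq
  have hαA : Matrix.vecMul α A = v p := by
    rw [Matrix.vecMul_vecMul, Matrix.nonsing_inv_mul A hdet, Matrix.vecMul_one]
  have hβA : Matrix.vecMul β A = v q := by
    rw [Matrix.vecMul_vecMul, Matrix.nonsing_inv_mul A hdet, Matrix.vecMul_one]
  have hsA : ∀ i, Matrix.vecMul (Pi.single i 1) A = v (e i) := fun i => by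
    rw [Matrix.single_one_vecMul]; rfl
  have hF1 := isHomogeneous_linSubst A hF
  have hF10 := linSubst_ne_zero hdet hF0
  set F1 := linSubst A F
  have hFα : VanishesToOrder F1 α a := VanishesToOrder.linSubst (by rwa [hαA])
  have hFβ : VanishesToOrder F1 β b := VanishesToOrder.linSubst (by rwa [hβA])
  have hFs : ∀ i, VanishesToOrder F1 (Pi.single i 1) (κ i).toNat := fun i =>
    VanishesToOrder.linSubst (by rw [hsA]; exact hκ i)
  have hk : ∀ a ∈ F1.support, ∀ i, (a i : ℤ) + κ i ≤ d := fun a ha i => by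
    have := (hFs i).exponent_add_le hF1 ha
    omega
  -- The constants `α i * β i` make the inversion exchange `α` and `β` up to scalars.
  have hG0 : cremona Finset.univ d κ (fun i => α i * β i) F1 ≠ 0 :=
    cremona_ne_zero (fun a ha i _ => hk a ha i) (fun i _ => mul_ne_zero (hα i) (hβ i)) hF10
  have hsum : ∀ a ∈ F1.support, ((∑ i, cremonaExponent Finset.univ d κ a i : ℕ) : ℤ) =
      n * d - ∑ i, κ i := by
    intro a ha
    rw [sum_cremonaExponent fun i _ => hk a ha i]
    have h2 : (∑ i, (a i : ℤ)) = d := by exact_mod_cast sum_exponent hF1 ha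
    simp only [h2, Finset.card_univ, Fintype.card_fin, Finset.compl_univ, Finset.sum_empty]
    push_cast
    ring
  -- A monomial of `F1` realises the integer `n * d - ∑ i, κ i` as a natural number, the degree of
  -- the transform.
  obtain ⟨a₀, ha₀⟩ := Finset.nonempty_iff_ne_empty.2 (mt MvPolynomial.support_eq_empty.1 hF10)
  have hGh := isHomogeneous_cremona_univ (c := fun i => α i * β i) (k := κ) hF1
    (e := ∑ i, cremonaExponent Finset.univ d κ a₀ i) (by
      rw [hsum a₀ ha₀, Fintype.card_fin]
      push_cast
      ring) hk
  have hd' := hsum a₀ ha₀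
  set d' := ∑ i, cremonaExponent Finset.univ d κ a₀ i
  have hdet' : IsUnit A⁻¹.det := Matrix.isUnit_nonsing_inv_det A hdet
  refine ⟨linSubst A⁻¹ (cremona Finset.univ d κ (fun i => α i * β i) F1), d',
    linSubst_ne_zero hdet' hG0, isHomogeneous_linSubst _ hGh, hd', fun i => ?_, ?_, ?_⟩
  · rw [← hsA]
    -- Exponents of the transform at `i` are `d - κ i - y i ≤ d - κ i`, which leaves order `d' - (d
    -- - κ i)`.
    refine VanishesToOrder.linSubst_inv hdet (vanishesToOrder_single hGh fun x hx => ?_)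
    have hle : x i ≤ d' := by
      rw [← sum_exponent hGh hx]
      exact Finset.single_le_sum (f := fun i => x i) (fun _ _ => Nat.zero_le _)
        (Finset.mem_univ i)
    obtain ⟨y, hy, rfl⟩ := exists_of_mem_support_cremona hx
    have := cremonaExponent_of_mem (Finset.mem_univ i) (hk y hy i)
    omega
  · rw [← hαA]
    refine VanishesToOrder.linSubst_inv hdet (VanishesToOrder.cremona hF1
      (fun a ha i _ => hk a ha i) (fun i _ => hα i) ?_)
    have hc : (∏ j, α j) ≠ 0 := Finset.prod_ne_zero_iff.2 fun i _ => hα i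
    -- The inversion with cleared denominators sends `α` to `(∏ j, α j) • β`.
    refine VanishesToOrder.of_smul hF1 (inv_ne_zero hc) ?_
    convert hFβ using 1
    funext i
    simp only [cremonaArc, Finset.mem_univ, if_true, Algebra.algebraMap_self, RingHom.id_apply,
      Pi.smul_apply, smul_eq_mul]
    rw [inv_mul_eq_iff_eq_mul₀ hc, ← Finset.mul_prod_erase _ _ (Finset.mem_univ i)]
    ring
  · rw [← hβA]
    refine VanishesToOrder.linSubst_inv hdet (VanishesToOrder.cremona hF1
      (fun a ha i _ => hk a ha i) (fun i _ => hβ i) ?_)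
    have hc : (∏ j, β j) ≠ 0 := Finset.prod_ne_zero_iff.2 fun i _ => hβ i
    refine VanishesToOrder.of_smul hF1 (inv_ne_zero hc) ?_
    convert hFα using 1
    funext i
    simp only [cremonaArc, Finset.mem_univ, if_true, Algebra.algebraMap_self, RingHom.id_apply,
      Pi.smul_apply, smul_eq_mul]
    rw [inv_mul_eq_iff_eq_mul₀ hc, ← Finset.mul_prod_erase _ _ (Finset.mem_univ i)]
    ring

/-- Successive Cremona transformations, omitting each pair of points once. -/
theorem exists_iterated_cremona_transform {m : ℕ} (hn : n = 2 * m + 1)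
    {v : Fin (m + 2) × Bool → Fin (n + 1) → L} (hv : InGeneralPosition v)
    {F : MvPolynomial (Fin (n + 1)) L} {d k : ℕ} (hF : F.IsHomogeneous d) (hF0 : F ≠ 0)
    (h : ∀ x, VanishesToOrder F (v x) k) (j : ℕ) (hj : j ≤ m + 2) :
    ∃ (G : MvPolynomial (Fin (n + 1)) L) (d' : ℕ), G ≠ 0 ∧ G.IsHomogeneous d' ∧
      (d' : ℤ) = d + j * (2 * m * d - (2 * m + 2) * k) ∧
      ∀ x, VanishesToOrder G (v x) ((k : ℤ) +
        (j - if x.1.val < j then 1 else 0) * (2 * m * d - (2 * m + 2) * k)).toNat := by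
  induction j with
  | zero => exact ⟨F, d, hF0, hF, by simp, by simpa using h⟩
  | succ j ih =>
    obtain ⟨G, d', hG0, hG, hd', hGv⟩ := ih (by omega)
    set ε : ℤ := 2 * m * d - (2 * m + 2) * k with hε
    -- Each step adds `ε` to the order at its base points and leaves it unchanged at the omitted
    -- pair, so pairs already omitted lag by one `ε`. These orders may be negative, hence integers
    -- with `toNat`.
    set κ : Fin (m + 2) × Bool → ℤ := fun x => k + (j - if x.1.val < j then 1 else 0) * ε
    set r : Fin (m + 2) := ⟨j, by omega⟩
    have hpq : (r, false) ≠ (r, true) := by simp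
    obtain ⟨e, he, hp, hq, hsurj, hsum⟩ := exists_enumeration_compl_pair (n := n)
      (by simp [hn]; omega) hpq
    obtain ⟨H, d'', hH0, hH, hd'', hHe, hHp, hHq⟩ := exists_cremona_transform hv he hp hq hG hG0
      (κ := fun i => κ (e i)) (fun i => hGv _) (hGv _) (hGv _)
    have hcount : ∑ x : Fin (m + 2) × Bool, (if x.1.val < j then (1 : ℤ) else 0) = 2 * j := by
      rw [Fintype.sum_prod_type]
      simp only [Fintype.sum_bool]
      rw [Finset.sum_add_distrib, Fin.sum_univ_eq_sum_range (fun i => if i < j then (1 : ℤ) else 0),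
        ← Finset.sum_filter, Finset.sum_const, show (Finset.range (m + 2)).filter (· < j) =
          Finset.range j by ext; simp; omega]
      simp
      ring
    have hκsum : ∑ i, κ (e i) = (2 * m + 2) * (k + j * ε) - 2 * j * ε := by
      rw [hsum]
      have h1 : κ (r, false) = k + j * ε := by simp [κ, r]
      have h2 : κ (r, true) = k + j * ε := by simp [κ, r]
      have h3 : ∑ x, κ x = (2 * m + 4) * (k + j * ε) - 2 * j * ε := by
        have : ∀ x, κ x = (k + j * ε) - (if x.1.val < j then 1 else 0) * ε := fun x => by
          simp only [κ]; ring
        simp only [this, Finset.sum_sub_distrib, ← Finset.sum_mul, hcount, Finset.sum_const,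
          Finset.card_univ, Fintype.card_prod, Fintype.card_fin, Fintype.card_bool, nsmul_eq_mul]
        push_cast
        ring
      linarith
    have hdeg : (d'' : ℤ) = d' + ε := by
      rw [hd'', hκsum, hd', hn]
      push_cast
      simp only [hε]
      ring
    refine ⟨H, d'', hH0, hH, by rw [hdeg, hd']; push_cast; ring, fun x => ?_⟩
    by_cases hx : x.1 = r
    · have hlt : x.1.val < j + 1 := by rw [hx]; simp [r]
      have hval : VanishesToOrder H (v x) ((k : ℤ) + j * ε).toNat := by
        obtain ⟨x1, b⟩ := x
        obtain rfl : x1 = r := hx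
        cases b
        · simpa [r] using hHp
        · simpa [r] using hHq
      simpa [hlt] using hval
    · obtain ⟨i, rfl⟩ := hsurj x (by rintro rfl; exact hx rfl) (by rintro rfl; exact hx rfl)
      have hxj : (e i).1.val ≠ j := fun h => hx (Fin.ext h)
      have hlt : (e i).1.val < j + 1 ↔ (e i).1.val < j := by omega
      convert hHe i using 2
      simp only [κ, hlt]
      rw [hdeg]
      push_cast
      ring

/-- The degree bound for forms vanishing to order `k` at `n + 3` points in general position, for
`n` odd. -/
theorem degree_bound_of_odd {m : ℕ} (hn : n = 2 * m + 1)
    {v : Fin (m + 2) × Bool → Fin (n + 1) → L} (hv : InGeneralPosition v)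
    {F : MvPolynomial (Fin (n + 1)) L} {d k : ℕ} (hF : F.IsHomogeneous d) (hF0 : F ≠ 0)
    (h : ∀ x, VanishesToOrder F (v x) k) :
    (2 * m + 4) * (m + 1) * k ≤ (2 * m ^ 2 + 4 * m + 1) * d := by
  -- After all `m + 2` pairs the degree is `d + (m + 2) * (2 * m * d - (2 * m + 2) * k)`; its
  -- nonnegativity is the bound.
  obtain ⟨_, d', -, -, hd', -⟩ := exists_iterated_cremona_transform hn hv hF hF0 h (m + 2) le_rfl
  have := Int.natCast_nonneg d'
  rw [hd'] at this
  zify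
  push_cast at this
  nlinarith

end CremonaStep

/-! ### Products and determinants in powers of ideals. -/

section Ideals

variable {R : Type*} [CommRing R]

theorem prod_mem_ideal_pow {ι : Type*} [DecidableEq ι] {I : Ideal R} {s s' : Finset ι}
    (hs : s' ⊆ s) {f : ι → R} {r e : ℕ} (hf : ∀ i ∈ s', f i ∈ I ^ r) (he : e ≤ s'.card * r) :
    ∏ i ∈ s, f i ∈ I ^ e := by
  rw [← Finset.prod_sdiff hs]
  refine Ideal.mul_mem_left _ _ (Ideal.pow_le_pow_right he ?_)
  have := Ideal.prod_mem_prod (I := fun _ => I ^ r) hf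
  rwa [Finset.prod_const, ← pow_mul, mul_comm] at this

/-- Every term of the Leibniz expansion takes one entry from each row in `s`. -/
theorem det_mem_ideal_pow {m : ℕ} {I : Ideal R} {M : Matrix (Fin m) (Fin m) R}
    {s : Finset (Fin m)} (hs : ∀ i ∈ s, ∀ j, M i j ∈ I) : M.det ∈ I ^ s.card := by
  rw [← Matrix.det_transpose, Matrix.det_apply]
  refine Submodule.sum_mem _ fun σ _ => ?_
  rw [Units.smul_def]
  refine zsmul_mem (prod_mem_ideal_pow (r := 1) (Finset.subset_univ s) (fun i hi => ?_)
    (by simp)) _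
  rw [pow_one]
  exact hs i hi _

/-- The determinant of a matrix which has rank one modulo an ideal. -/
theorem det_mem_ideal_pow_of_rank_one {m : ℕ} {I : Ideal R}
    {M : Matrix (Fin (m + 1)) (Fin (m + 1)) R} {u w : Fin (m + 1) → R}
    (h : ∀ k l, M k l - u k * w l ∈ I) : M.det ∈ I ^ m := by
  -- Multilinear expansion over the set `s` of rows taken from the part in `I`. Once two rows come
  -- from the rank-one part, the determinant is zero, so only `m ≤ s.card` contributes.
  set N : Finset (Fin (m + 1)) → Matrix (Fin (m + 1)) (Fin (m + 1)) R := fun s =>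
    Matrix.of fun k l => if k ∈ s then M k l - u k * w l else u k * w l with hN
  have hdet : M.det = ∑ s, (N s).det := by
    have h1 := Matrix.detRowAlternating.map_add_univ (R := R)
      (fun k l => M k l - u k * w l) (fun k l => u k * w l)
    have h2 : ((fun k l => M k l - u k * w l) + fun k l => u k * w l) = M := by
      funext k l
      simp
    rw [h2] at h1
    refine h1.trans (Finset.sum_congr rfl fun s _ => congrArg Matrix.detRowAlternating ?_)
    funext k l
    by_cases hk : k ∈ s <;> simp [hN, hk]
  rw [hdet]
  refine Submodule.sum_mem _ fun s _ => ?_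
  by_cases hs : m ≤ s.card
  · refine Ideal.pow_le_pow_right hs (det_mem_ideal_pow fun i hi j => ?_)
    simpa [hN, hi] using h i j
  · have hc : 1 < sᶜ.card := by rw [Finset.card_compl, Fintype.card_fin]; omega
    obtain ⟨i, hi, j, hj, hij⟩ := Finset.one_lt_card.1 hc
    rw [Finset.mem_compl] at hi hj
    set N' : Matrix (Fin (m + 1)) (Fin (m + 1)) R := Matrix.of fun r l =>
      if r ∈ s then M r l - u r * w l else w l
    have hN' : N s = Matrix.of fun r l => (if r ∈ s then 1 else u r) * N' r l := by
      ext r l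
      by_cases hr : r ∈ s <;> simp [hr, N', hN]
    rw [hN', Matrix.det_mul_column, Matrix.det_zero_of_row_eq hij (by
      funext l
      simp [N', hi, hj]), mul_zero]
    exact zero_mem _

end Ideals

/-! ### From an extremal form to the limit. -/

section Limit

variable {K : Type*} [Field K] {n : ℕ} {Z : Finset (ProjSpace K n)}

theorem mem_symbolicPower {k : ℕ} {F : MvPolynomial (Fin (n + 1)) K} :
    F ∈ symbolicPower Z k ↔ ∀ P ∈ Z, F ∈ pointIdeal P ^ k := by
  simp [symbolicPower]

/-- A form attaining a linear degree bound computes the Waldschmidt constant. -/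
theorem hasWaldschmidtConstant_of_extremal {D M : ℕ} (hM : 0 < M)
    {H : MvPolynomial (Fin (n + 1)) K} (hH : H ∈ symbolicPower Z M) (hHD : H.IsHomogeneous D)
    (hH0 : H ≠ 0)
    (hlow : ∀ (k d : ℕ) (F : MvPolynomial (Fin (n + 1)) K), F ∈ symbolicPower Z k →
      F.IsHomogeneous d → F ≠ 0 → D * k ≤ M * d) :
    HasWaldschmidtConstant Z ((D : ℝ) / M) := by
  have hpow : ∀ k q : ℕ, k ≤ M * q →
      D * q ∈ {j : ℕ | ∃ F ∈ symbolicPower Z k, F.IsHomogeneous j ∧ F ≠ 0} := by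
    intro k q hkq
    refine ⟨H ^ q, mem_symbolicPower.2 fun P hP => ?_, hHD.pow q, pow_ne_zero _ hH0⟩
    refine Ideal.pow_le_pow_right hkq ?_
    rw [pow_mul]
    exact Ideal.pow_mem_pow (mem_symbolicPower.1 hH P hP) q
  have hM' : (0 : ℝ) < M := by exact_mod_cast hM
  refine tendsto_of_tendsto_of_tendsto_of_le_of_le' (g := fun _ : ℕ => (D : ℝ) / M)
    (h := fun k : ℕ => (D : ℝ) / M + D / (k : ℝ)) tendsto_const_nhds ?_ ?_ ?_
  · have := (tendsto_const_nhds (x := (D : ℝ) / M) (f := (atTop : Filter ℕ))).add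
      (tendsto_const_div_atTop_nhds_zero_nat (D : ℝ))
    simpa using this
  · filter_upwards [eventually_gt_atTop 0] with k hk
    have hk' : (0 : ℝ) < k := by exact_mod_cast hk
    obtain ⟨F, hF, hFd, hF0⟩ := Nat.sInf_mem ⟨_, hpow k k (Nat.le_mul_of_pos_left k hM)⟩
    have h : D * k ≤ M * initialDegree (symbolicPower Z k) := hlow k _ F hF hFd hF0
    rw [div_le_div_iff₀ hM' hk']
    rw [mul_comm (initialDegree _ : ℝ)]
    exact_mod_cast h
  · filter_upwards [eventually_gt_atTop 0] with k hk
    have hk' : (0 : ℝ) < k := by exact_mod_cast hk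
    -- The power `H ^ (k / M + 1)`, with floor division, is the first one guaranteed to have
    -- multiplicity at least `k`.
    have h : initialDegree (symbolicPower Z k) ≤ D * (k / M + 1) :=
      Nat.sInf_le (hpow k _ (Nat.lt_mul_div_succ k hM).le)
    have h' : (initialDegree (symbolicPower Z k) : ℝ) ≤ D * ((k : ℝ) / M + 1) := by
      refine (Nat.cast_le.2 h).trans ?_
      push_cast
      gcongr
      exact Nat.cast_div_le
    rw [div_le_iff₀ hk']
    refine h'.trans (le_of_eq ?_)
    field_simp

end Limit

/-! ### The extremal product of hyperplanes for `n + 2` points. -/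

section CoordinateForms

variable {K : Type*} [Field K] {n : ℕ}

/-- The linear form computing the `i`-th coordinate with respect to the basis of the rows
of `A`. -/
noncomputable def coordForm (A : Matrix (Fin (n + 1)) (Fin (n + 1)) K) (i : Fin (n + 1)) :
    MvPolynomial (Fin (n + 1)) K :=
  ∑ j, MvPolynomial.C (A⁻¹ j i) * MvPolynomial.X j

theorem eval_coordForm (A : Matrix (Fin (n + 1)) (Fin (n + 1)) K) (i : Fin (n + 1))
    (w : Fin (n + 1) → K) :
    MvPolynomial.eval w (coordForm A i) = Matrix.vecMul w A⁻¹ i := by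
  simp [coordForm, Matrix.vecMul, dotProduct, mul_comm]

theorem isHomogeneous_coordForm (A : Matrix (Fin (n + 1)) (Fin (n + 1)) K) (i : Fin (n + 1)) :
    (coordForm A i).IsHomogeneous 1 :=
  MvPolynomial.IsHomogeneous.sum _ _ _ fun j _ => by
    simpa using (MvPolynomial.isHomogeneous_C (Fin (n + 1)) (A⁻¹ j i)).mul
      (MvPolynomial.isHomogeneous_X K j)

theorem vecMul_inv_row {A : Matrix (Fin (n + 1)) (Fin (n + 1)) K} (hA : A.det ≠ 0)
    (l : Fin (n + 1)) : Matrix.vecMul (A l) A⁻¹ = Pi.single l 1 := by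
  have : A l = Matrix.vecMul (Pi.single l 1) A := by rw [Matrix.single_one_vecMul]; rfl
  rw [this, Matrix.vecMul_vecMul, Matrix.mul_nonsing_inv A hA.isUnit, Matrix.vecMul_one]

theorem mem_pointIdeal {P : ProjSpace K n} {F : MvPolynomial (Fin (n + 1)) K} {d : ℕ}
    (hF : F.IsHomogeneous d) (h : MvPolynomial.eval P.rep F = 0) : F ∈ pointIdeal P :=
  Ideal.subset_span ⟨⟨d, hF⟩, h⟩

/-- A product of hyperplanes with high multiplicity at `n + 1` independent points and at one
further point. -/
theorem exists_hyperplane_product {p : Fin (n + 1) → ProjSpace K n}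
    (hA : (Matrix.of fun i => (p i).rep).det ≠ 0) (Q : ProjSpace K n) {S : Finset (Fin (n + 1))}
    (hS : ∀ i, i ∈ S ↔ Matrix.vecMul Q.rep (Matrix.of fun i => (p i).rep)⁻¹ i ≠ 0) :
    ∃ H : MvPolynomial (Fin (n + 1)) K, H ≠ 0 ∧
      H.IsHomogeneous (S.card * (S.card + 2 * Sᶜ.card + 1)) ∧
      (∀ l, H ∈ pointIdeal (p l) ^ (S.card * (S.card + 2 * Sᶜ.card - 1))) ∧
      H ∈ pointIdeal Q ^ (S.card * (S.card + 2 * Sᶜ.card - 1)) := by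
  set A : Matrix (Fin (n + 1)) (Fin (n + 1)) K := Matrix.of fun i => (p i).rep with hAdef
  set c := Matrix.vecMul Q.rep A⁻¹ with hc
  set ξ := coordForm A with hξ
  have hξ1 : ∀ i, (ξ i).IsHomogeneous 1 := isHomogeneous_coordForm A
  have hrow : ∀ l i, MvPolynomial.eval (p l).rep (ξ i) = if i = l then 1 else 0 := fun l i => by
    rw [hξ, eval_coordForm, show (p l).rep = A l from rfl, vecMul_inv_row hA, Pi.single_apply]
  have hQ : ∀ i, MvPolynomial.eval Q.rep (ξ i) = c i := fun i => eval_coordForm A i _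
  have hξp : ∀ l i, i ≠ l → ξ i ∈ pointIdeal (p l) := fun l i h =>
    mem_pointIdeal (hξ1 i) (by rw [hrow, if_neg h])
  set η : Fin (n + 1) → Fin (n + 1) → MvPolynomial (Fin (n + 1)) K := fun i j =>
    MvPolynomial.C (c j) * ξ i - MvPolynomial.C (c i) * ξ j with hη
  have hη1 : ∀ i j, (η i j).IsHomogeneous 1 := fun i j =>
    ((hξ1 i).C_mul _).sub ((hξ1 j).C_mul _)
  have hηp : ∀ l i j, i ≠ l → j ≠ l → η i j ∈ pointIdeal (p l) := fun l i j hi hj =>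
    Ideal.sub_mem _ (Ideal.mul_mem_left _ _ (hξp l i hi)) (Ideal.mul_mem_left _ _ (hξp l j hj))
  have hξ0 : ∀ i, ξ i ≠ 0 := fun i h => by
    have := hrow i i
    rw [h] at this
    simp at this
  set s := S.card with hs
  set o := Sᶜ.card with ho
  obtain hs0 | hs0 := Nat.eq_zero_or_pos s
  -- For `s = 0` the degree and the multiplicities asked for are all 0.
  · exact ⟨1, one_ne_zero, by simpa [hs0] using MvPolynomial.isHomogeneous_one _ _,
      by simp [hs0], by simp [hs0]⟩
  have hpos : s ≠ 0 := hs0.ne'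
  obtain ⟨s', hs'⟩ := Nat.exists_eq_succ_of_ne_zero hpos
  have hmul : s * (s + 2 * o - 1) = o * (2 * s) + s * (s - 1) := by
    rw [hs']
    have : s' + 1 + 2 * o - 1 = s' + 2 * o := by omega
    rw [Nat.succ_eq_add_one, this, Nat.add_sub_cancel]
    ring
  -- The hyperplane `η i j` passes through `Q` and all `p l` with `l ≠ i, j`. The exponents `2 * s`
  -- and `2` balance the multiplicities: the factors give `2 * s * o + s * (s - 1)` at `Q` and at
  -- every `p l`, whether or not `l ∈ S`.
  refine ⟨(∏ i ∈ Sᶜ, ξ i ^ (2 * s)) * (∏ i ∈ S, ξ i ^ 2) * ∏ i ∈ S, ∏ j ∈ S.erase i, η i j,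
    ?_, ?_, fun l => ?_, ?_⟩
  · refine mul_ne_zero (mul_ne_zero ?_ ?_) ?_
    · exact Finset.prod_ne_zero_iff.2 fun i _ => pow_ne_zero _ (hξ0 i)
    · exact Finset.prod_ne_zero_iff.2 fun i _ => pow_ne_zero _ (hξ0 i)
    · refine Finset.prod_ne_zero_iff.2 fun i _ => Finset.prod_ne_zero_iff.2 fun j hj h0 => ?_
      have h1 := congrArg (MvPolynomial.eval (p i).rep) h0
      simp only [η, map_sub, map_mul, MvPolynomial.eval_C, hrow, if_true, mul_one, map_zero,
        if_neg (Finset.ne_of_mem_erase hj), mul_zero, sub_zero] at h1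
      exact (hS j).1 (Finset.mem_of_mem_erase hj) h1
  · have h1 := MvPolynomial.IsHomogeneous.prod Sᶜ (fun i => ξ i ^ (2 * s)) (fun _ => 2 * s)
      (fun i _ => by simpa using (hξ1 i).pow (2 * s))
    have h2 := MvPolynomial.IsHomogeneous.prod S (fun i => ξ i ^ 2) (fun _ => 2)
      (fun i _ => by simpa using (hξ1 i).pow 2)
    have h3 := MvPolynomial.IsHomogeneous.prod S (fun i => ∏ j ∈ S.erase i, η i j)
      (fun _ => s - 1) (fun i hi => by
        have := MvPolynomial.IsHomogeneous.prod (S.erase i) (fun j => η i j) (fun _ => 1)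
          (fun j _ => hη1 i j)
        rwa [Finset.sum_const, Finset.card_erase_of_mem hi, smul_eq_mul, mul_one] at this)
    convert (h1.mul h2).mul h3 using 1
    simp only [Finset.sum_const, smul_eq_mul, ← hs, ← ho]
    rw [hs', Nat.succ_eq_add_one, Nat.add_sub_cancel]
    ring
  · by_cases hl : l ∈ S
    · have h1 : ∏ i ∈ Sᶜ, ξ i ^ (2 * s) ∈ pointIdeal (p l) ^ (o * (2 * s)) :=
        prod_mem_ideal_pow (Finset.Subset.refl _) (fun i hi => Ideal.pow_mem_pow
          (hξp l i fun h => Finset.mem_compl.1 hi (h ▸ hl)) _) le_rfl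
      have h2 : ∏ i ∈ S, ξ i ^ 2 ∈ pointIdeal (p l) ^ ((s - 1) * 2) :=
        prod_mem_ideal_pow (Finset.erase_subset l S) (fun i hi => Ideal.pow_mem_pow
          (hξp l i (Finset.ne_of_mem_erase hi)) _) (by rw [Finset.card_erase_of_mem hl])
      have h3 : ∏ i ∈ S, ∏ j ∈ S.erase i, η i j ∈ pointIdeal (p l) ^ ((s - 1) * (s - 2)) := by
        refine prod_mem_ideal_pow (r := s - 2) (Finset.erase_subset l S) (fun i hi => ?_)
          (by rw [Finset.card_erase_of_mem hl])
        have hil := Finset.ne_of_mem_erase hi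
        refine prod_mem_ideal_pow (r := 1) (Finset.erase_subset l (S.erase i)) (fun j hj => ?_) ?_
        · rw [pow_one]
          exact hηp l i j hil (Finset.ne_of_mem_erase hj)
        · rw [Finset.card_erase_of_mem (Finset.mem_erase.2 ⟨hil.symm, hl⟩),
            Finset.card_erase_of_mem (Finset.mem_of_mem_erase hi)]
          omega
      have := Ideal.mul_mem_mul (Ideal.mul_mem_mul h1 h2) h3
      rw [← pow_add, ← pow_add] at this
      refine Ideal.pow_le_pow_right ?_ this
      rw [hmul, add_assoc]
      refine Nat.add_le_add_left ?_ _
      rw [hs', Nat.succ_eq_add_one, Nat.add_sub_cancel]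
      cases s' with
      | zero => simp
      | succ r => simp only [show r + 1 + 1 - 2 = r by omega]; nlinarith
    · have h1 : ∏ i ∈ Sᶜ, ξ i ^ (2 * s) ∈ pointIdeal (p l) ^ ((o - 1) * (2 * s)) :=
        prod_mem_ideal_pow (Finset.erase_subset l Sᶜ) (fun i hi => Ideal.pow_mem_pow
          (hξp l i (Finset.ne_of_mem_erase hi)) _)
          (by rw [Finset.card_erase_of_mem (Finset.mem_compl.2 hl)])
      have hne : ∀ i ∈ S, i ≠ l := fun i hi h => hl (h ▸ hi)
      have h2 : ∏ i ∈ S, ξ i ^ 2 ∈ pointIdeal (p l) ^ (s * 2) :=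
        prod_mem_ideal_pow (Finset.Subset.refl _) (fun i hi => Ideal.pow_mem_pow
          (hξp l i (hne i hi)) _) le_rfl
      have h3 : ∏ i ∈ S, ∏ j ∈ S.erase i, η i j ∈ pointIdeal (p l) ^ (s * (s - 1)) := by
        refine prod_mem_ideal_pow (r := s - 1) (Finset.Subset.refl _) (fun i hi => ?_) le_rfl
        refine prod_mem_ideal_pow (r := 1) (Finset.Subset.refl _) (fun j hj => ?_) ?_
        · rw [pow_one]
          exact hηp l i j (hne i hi) (hne j (Finset.mem_of_mem_erase hj))
        · rw [Finset.card_erase_of_mem hi, mul_one]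
      have := Ideal.mul_mem_mul (Ideal.mul_mem_mul h1 h2) h3
      rw [← pow_add, ← pow_add] at this
      refine Ideal.pow_le_pow_right ?_ this
      rw [hmul]
      refine Nat.add_le_add_right ?_ _
      have : 0 < o := Finset.card_pos.2 ⟨l, Finset.mem_compl.2 hl⟩
      obtain ⟨o', ho'⟩ := Nat.exists_eq_succ_of_ne_zero this.ne'
      rw [ho', Nat.succ_eq_add_one, Nat.add_sub_cancel]
      nlinarith
  · have h1 : ∏ i ∈ Sᶜ, ξ i ^ (2 * s) ∈ pointIdeal Q ^ (o * (2 * s)) :=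
      prod_mem_ideal_pow (Finset.Subset.refl _) (fun i hi => Ideal.pow_mem_pow
        (mem_pointIdeal (hξ1 i) (by
          rw [hQ]
          exact by_contra fun h => Finset.mem_compl.1 hi ((hS i).2 h))) _) le_rfl
    have h3 : ∏ i ∈ S, ∏ j ∈ S.erase i, η i j ∈ pointIdeal Q ^ (s * (s - 1)) := by
      refine prod_mem_ideal_pow (r := s - 1) (Finset.Subset.refl _) (fun i hi => ?_) le_rfl
      refine prod_mem_ideal_pow (r := 1) (Finset.Subset.refl _) (fun j hj => ?_) ?_
      · rw [pow_one]
        refine mem_pointIdeal (hη1 i j) ?_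
        simp only [η, map_sub, map_mul, MvPolynomial.eval_C, hQ]
        ring
      · rw [Finset.card_erase_of_mem hi, mul_one]
    have := Ideal.mul_mem_mul (Ideal.mul_mem_right (∏ i ∈ S, ξ i ^ 2) _ h1) h3
    rw [← pow_add] at this
    rwa [hmul]

end CoordinateForms

/-! ### Hankel determinants and secant cones for `n + 3` points. -/

section Determinantal

variable {K : Type*} [Field K] {n : ℕ}

/-- The weights are the Lagrange basis polynomials at 0: interpolating `X ^ r` at the nodes is exact
for `r < N`, and its value at 0 vanishes for `r > 0`. -/
theorem exists_weights {N : ℕ} {b : Fin N → K} (hb : Function.Injective b) (hb0 : ∀ i, b i ≠ 0) :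
    ∃ μ : Fin N → K, (∀ i, μ i ≠ 0) ∧ ∀ r, 0 < r → r < N → ∑ i, μ i * b i ^ r = 0 := by
  refine ⟨fun i => (Lagrange.basis Finset.univ b i).eval 0, fun i => ?_, fun r hr hrN => ?_⟩
  · simp only [Lagrange.basis, Polynomial.eval_prod, Lagrange.basisDivisor, Polynomial.eval_mul,
      Polynomial.eval_C, Polynomial.eval_sub, Polynomial.eval_X, zero_sub]
    exact Finset.prod_ne_zero_iff.2 fun j hj => mul_ne_zero
      (inv_ne_zero (sub_ne_zero.2 (hb.ne (Finset.ne_of_mem_erase hj).symm))) (neg_ne_zero.2 (hb0 j))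
  · have h := Lagrange.eq_interpolate (s := Finset.univ) (v := b) (hb.injOn)
      (f := (Polynomial.X : Polynomial K) ^ r) (by simpa using hrN)
    have h1 := congrArg (Polynomial.eval 0) h
    rw [Lagrange.interpolate_apply, Polynomial.eval_finsetSum] at h1
    simp only [Polynomial.eval_pow, Polynomial.eval_X, zero_pow hr.ne', Polynomial.eval_mul,
      Polynomial.eval_C] at h1
    exact (Finset.sum_congr rfl fun i _ => mul_comm _ _).trans h1.symm

/-- Hankel determinants: the secant variety of a rational normal curve, or a cone over it. -/
theorem exists_hankel_form {m : ℕ} {ξ : Fin (2 * m + 1) → MvPolynomial (Fin (n + 1)) K}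
    (hξ : ∀ i, (ξ i).IsHomogeneous 1)
    (hsurj : ∀ y : Fin (2 * m + 1) → K, ∃ x, ∀ i, MvPolynomial.eval x (ξ i) = y i)
    {α β : Fin (2 * m + 1) → K} (hα : ∀ i, α i ≠ 0) (hβ : ∀ i, β i ≠ 0)
    (hαβ : ∀ i j, i ≠ j → β i * α j ≠ β j * α i) :
    ∃ H : MvPolynomial (Fin (n + 1)) K, H ≠ 0 ∧ H.IsHomogeneous (m + 1) ∧
      ∀ P : ProjSpace K n,
        ((∀ i, MvPolynomial.eval P.rep (ξ i) = 0) → H ∈ pointIdeal P ^ (m + 1)) ∧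
        ((∃ i, ∀ j, j ≠ i → MvPolynomial.eval P.rep (ξ j) = 0) → H ∈ pointIdeal P ^ m) ∧
        ((∀ i, MvPolynomial.eval P.rep (ξ i) = α i) → H ∈ pointIdeal P ^ m) ∧
        ((∀ i, MvPolynomial.eval P.rep (ξ i) = β i) → H ∈ pointIdeal P ^ m) := by
  set b : Fin (2 * m + 1) → K := fun i => β i / α i with hbdef
  have hb : Function.Injective b := fun i j hij => by
    by_contra hne
    exact hαβ i j hne ((div_eq_div_iff (hα i) (hα j)).1 hij)
  obtain ⟨μ, hμ, hμsum⟩ := exists_weights hb fun i => div_ne_zero (hβ i) (hα i)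
  -- A combination of the rank-one matrices `b i ^ (k + l)`, weighted so that its values at `α` and
  -- `β` also have rank at most one.
  set M : Matrix (Fin (m + 1)) (Fin (m + 1)) (MvPolynomial (Fin (n + 1)) K) :=
    Matrix.of fun k l => ∑ i, MvPolynomial.C (μ i / α i * b i ^ (k.val + l.val)) * ξ i with hM
  have hM1 : ∀ k l, (M k l).IsHomogeneous 1 := fun k l => by
    rw [hM, Matrix.of_apply]
    exact MvPolynomial.IsHomogeneous.sum _ _ _ fun i _ => (hξ i).C_mul _
  have hMeval : ∀ w k l, MvPolynomial.eval w (M k l) =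
      ∑ i, μ i / α i * b i ^ (k.val + l.val) * MvPolynomial.eval w (ξ i) := fun w k l => by
    simp [hM]
  refine ⟨M.det, ?_, ?_, fun P => ⟨fun h => ?_, ?_, fun h => ?_, fun h => ?_⟩⟩
  · set f : Fin (m + 1) → Fin (2 * m + 1) := Fin.castLE (by omega) with hf
    have hfi : Function.Injective f := Fin.castLE_injective _
    -- At this `x`, only `m + 1` of the rank-one matrices survive, each with coefficient 1, and
    -- their sum is a Gram product of Vandermonde matrices with distinct nodes.
    obtain ⟨x, hx⟩ := hsurj (Function.extend f (fun i => (μ (f i) / α (f i))⁻¹) 0)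
    intro h0
    have h1 := congrArg (MvPolynomial.eval x) h0
    rw [RingHom.map_det, map_zero] at h1
    have h2 : (MvPolynomial.eval x).mapMatrix M =
        (Matrix.vandermonde (b ∘ f)).transpose * Matrix.vandermonde (b ∘ f) := by
      ext k l
      rw [RingHom.mapMatrix_apply, Matrix.map_apply, hMeval, Matrix.mul_apply]
      simp only [Matrix.transpose_apply, Matrix.vandermonde_apply, hx, Function.comp_apply,
        ← pow_add]
      rw [← Finset.sum_subset (Finset.subset_univ (Finset.univ.image f)) (by
        intro i _ hi
        rw [Function.extend_apply' _ _ _ (by simpa using hi)]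
        simp), Finset.sum_image hfi.injOn]
      refine Finset.sum_congr rfl fun i _ => ?_
      rw [hfi.extend_apply]
      have := hμ (f i)
      have := hα (f i)
      field_simp
    rw [h2, Matrix.det_mul, Matrix.det_transpose] at h1
    have h3 := Matrix.det_vandermonde_ne_zero_iff.2 (hb.comp hfi)
    exact mul_ne_zero h3 h3 h1
  · rw [Matrix.det_apply, ← MvPolynomial.mem_homogeneousSubmodule]
    refine Submodule.sum_mem _ fun σ _ => ?_
    rw [Units.smul_def]
    refine zsmul_mem ?_ _
    rw [MvPolynomial.mem_homogeneousSubmodule]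
    have := MvPolynomial.IsHomogeneous.prod Finset.univ (fun i => M (σ i) i) (fun _ => 1)
      (fun i _ => hM1 _ _)
    simpa using this
  · have := det_mem_ideal_pow (I := pointIdeal P) (M := M) (s := Finset.univ) fun i _ j =>
      mem_pointIdeal (hM1 i j) (by
        rw [hMeval]
        exact Finset.sum_eq_zero fun i _ => by rw [h, mul_zero])
    simpa using this
  · rintro ⟨i, hi⟩
    refine det_mem_ideal_pow_of_rank_one
      (u := fun k => MvPolynomial.C (μ i / α i * b i ^ k.val) * ξ i)
      (w := fun l => MvPolynomial.C (b i ^ l.val)) fun k l => ?_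
    have : M k l - MvPolynomial.C (μ i / α i * b i ^ k.val) * ξ i * MvPolynomial.C (b i ^ l.val) =
        ∑ j ∈ Finset.univ.erase i, MvPolynomial.C (μ j / α j * b j ^ (k.val + l.val)) * ξ j := by
      rw [Finset.sum_erase_eq_sub (Finset.mem_univ i), hM, Matrix.of_apply]
      congr 1
      rw [pow_add, ← mul_assoc, map_mul _ (μ i / α i * b i ^ k.val)]
      ring
    rw [this]
    exact Ideal.sum_mem _ fun j hj => Ideal.mul_mem_left _ _
      (mem_pointIdeal (hξ j) (hi j (Finset.ne_of_mem_erase hj)))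
  -- At `α` the entries are `∑ i, μ i * b i ^ (k + l)`, zero except in the corner `k = l = 0`.
  · refine det_mem_ideal_pow_of_rank_one (u := Pi.single 0 (M 0 0)) (w := Pi.single 0 1)
      fun k l => ?_
    by_cases hkl : k = 0 ∧ l = 0
    · obtain ⟨rfl, rfl⟩ := hkl
      simp
    · have h0 : (Pi.single 0 (M 0 0) : Fin (m + 1) → _) k * (Pi.single 0 1 : Fin (m + 1) → _) l
          = 0 := by
        by_cases hk : k = 0
        · rw [Pi.single_eq_of_ne (M := fun _ => MvPolynomial (Fin (n + 1)) K)
            (fun hl => hkl ⟨hk, hl⟩), mul_zero]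
        · rw [Pi.single_eq_of_ne (M := fun _ => MvPolynomial (Fin (n + 1)) K) hk, zero_mul]
      rw [h0, sub_zero]
      refine mem_pointIdeal (hM1 k l) ?_
      rw [hMeval, ← hμsum (k.val + l.val) ?_ (by omega)]
      · refine Finset.sum_congr rfl fun i _ => ?_
        rw [h]
        have := hα i
        field_simp
      · rw [Fin.ext_iff, Fin.ext_iff] at hkl
        simp only [Fin.val_zero] at hkl
        omega
  -- At `β` the exponent is `k + l + 1`, which stays below `2 * m + 1` except in the corner `k = l =
  -- m`.
  · refine det_mem_ideal_pow_of_rank_one (u := Pi.single (Fin.last m) (M (Fin.last m) (Fin.last m)))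
      (w := Pi.single (Fin.last m) 1) fun k l => ?_
    by_cases hkl : k = Fin.last m ∧ l = Fin.last m
    · obtain ⟨rfl, rfl⟩ := hkl
      simp
    · have h0 : (Pi.single (Fin.last m) (M (Fin.last m) (Fin.last m)) : Fin (m + 1) → _) k *
          (Pi.single (Fin.last m) 1 : Fin (m + 1) → _) l = 0 := by
        by_cases hk : k = Fin.last m
        · rw [Pi.single_eq_of_ne (M := fun _ => MvPolynomial (Fin (n + 1)) K)
            (fun hl => hkl ⟨hk, hl⟩), mul_zero]
        · rw [Pi.single_eq_of_ne (M := fun _ => MvPolynomial (Fin (n + 1)) K) hk, zero_mul]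
      rw [h0, sub_zero]
      refine mem_pointIdeal (hM1 k l) ?_
      rw [hMeval, ← hμsum (k.val + l.val + 1) (by omega) ?_]
      · refine Finset.sum_congr rfl fun i _ => ?_
        rw [h, pow_succ, hbdef]
        have := hα i
        field_simp
      · rw [Fin.ext_iff, Fin.ext_iff] at hkl
        simp only [Fin.val_last] at hkl
        omega

variable {τ : Type*}

/-- Two points of a configuration in general position have no proportional pairs of coordinates
with respect to the remaining ones. -/
theorem InGeneralPosition.coord_mul_ne {v : τ → Fin (n + 1) → K} (hv : InGeneralPosition v)
    {e : Fin (n + 1) → τ} (he : Function.Injective e) {p q : τ} (hpq : p ≠ q) (hp : ∀ i, e i ≠ p)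
    (hq : ∀ i, e i ≠ q) {i j : Fin (n + 1)} (hij : i ≠ j) :
    Matrix.vecMul (v q) (Matrix.of (v ∘ e))⁻¹ i * Matrix.vecMul (v p) (Matrix.of (v ∘ e))⁻¹ j ≠
      Matrix.vecMul (v q) (Matrix.of (v ∘ e))⁻¹ j *
        Matrix.vecMul (v p) (Matrix.of (v ∘ e))⁻¹ i := by
  classical
  intro heq
  set A := Matrix.of (v ∘ e) with hA
  have hdet : A.det ≠ 0 := hv e he
  set α := Matrix.vecMul (v p) A⁻¹ with hα
  set e' : Fin (n + 1) → τ := fun r => if r = i then p else if r = j then q else e r with he'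
  have hinj : Function.Injective e' := by
    intro a b hab
    simp only [he'] at hab
    have := hpq.symm
    have h1 := fun r => (hp r).symm
    have h2 := fun r => (hq r).symm
    split_ifs at hab <;> first
      | exact he hab
      | (subst_vars; first | rfl | contradiction)
      | exact absurd hab (hp _)
      | exact absurd hab (hq _)
      | exact absurd hab (h1 _)
      | exact absurd hab (h2 _)
  -- A proportionality would put `p`, `q` and the `e r` with `r ≠ i, j` on the hyperplane `w`: these
  -- are `n + 1` points.
  set w : Fin (n + 1) → K := fun r => A⁻¹ r i * α j - A⁻¹ r j * α i with hw
  have hdot : ∀ x : Fin (n + 1) → K, x ⬝ᵥ w =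
      Matrix.vecMul x A⁻¹ i * α j - Matrix.vecMul x A⁻¹ j * α i := fun x => by
    simp only [dotProduct, hw, mul_sub, Finset.sum_sub_distrib, Matrix.vecMul, Finset.sum_mul,
      mul_assoc]
  have hrow : ∀ r, Matrix.vecMul (v (e r)) A⁻¹ = Pi.single r 1 := fun r => vecMul_inv_row hdet r
  refine hv e' hinj (Matrix.exists_mulVec_eq_zero_iff.1 ⟨w, fun h0 => ?_, ?_⟩)
  · have h1 := hdot (v (e i))
    rw [h0, dotProduct_zero, hrow, Pi.single_eq_same, Pi.single_eq_of_ne hij.symm, one_mul,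
      zero_mul, sub_zero] at h1
    exact hv.coord_ne_zero he hp j h1.symm
  · funext r
    change v (e' r) ⬝ᵥ w = 0
    rw [hdot]
    simp only [he']
    split_ifs with h1 h2
    · rw [← hα]; ring
    · rw [sub_eq_zero]; exact heq
    · rw [hrow, Pi.single_eq_of_ne (Ne.symm h1), Pi.single_eq_of_ne (Ne.symm h2)]
      ring

/-- The map `f` selects the coordinates entering the Hankel matrix. Points `e i` with `i` not
selected lie in the vertex of the cone and gain one in multiplicity. The case of all coordinates
serves even `n`; omitting one serves odd `n`. -/
theorem exists_secant_form {P : τ → ProjSpace K n}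
    (hP : InGeneralPosition fun x => (P x).rep) {e : Fin (n + 1) → τ}
    (he : Function.Injective e) {p q : τ} (hpq : p ≠ q) (hp : ∀ i, e i ≠ p) (hq : ∀ i, e i ≠ q)
    (hsurj : ∀ x, x ≠ p → x ≠ q → ∃ i, e i = x) {m : ℕ} {f : Fin (2 * m + 1) → Fin (n + 1)}
    (hf : Function.Injective f) :
    ∃ H : MvPolynomial (Fin (n + 1)) K, H ≠ 0 ∧ H.IsHomogeneous (m + 1) ∧
      (∀ x, H ∈ pointIdeal (P x) ^ m) ∧
      ∀ i, (∀ j, f j ≠ i) → H ∈ pointIdeal (P (e i)) ^ (m + 1) := by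
  set A := Matrix.of ((fun x => (P x).rep) ∘ e) with hA
  have hdet : A.det ≠ 0 := hP e he
  have hrow : ∀ r i, MvPolynomial.eval (P (e r)).rep (coordForm A i) =
      (Pi.single r 1 : Fin (n + 1) → K) i := fun r i => by
    rw [eval_coordForm, ← vecMul_inv_row hdet r]; rfl
  obtain ⟨H, hH0, hH, hHP⟩ := exists_hankel_form (ξ := fun i => coordForm A (f i))
    (fun i => isHomogeneous_coordForm A _)
    (fun y => ⟨Matrix.vecMul (Function.extend f y 0) A, fun i => by
      rw [eval_coordForm, Matrix.vecMul_vecMul, Matrix.mul_nonsing_inv A hdet.isUnit,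
        Matrix.vecMul_one, hf.extend_apply]⟩)
    (α := fun i => Matrix.vecMul (P p).rep A⁻¹ (f i))
    (β := fun i => Matrix.vecMul (P q).rep A⁻¹ (f i))
    (fun i => hP.coord_ne_zero he hp _) (fun i => hP.coord_ne_zero he hq _)
    (fun i j hij => hP.coord_mul_ne he hpq hp hq (hf.ne hij))
  have hcone : ∀ i, (∀ j, f j ≠ i) → H ∈ pointIdeal (P (e i)) ^ (m + 1) := fun i hi =>
    (hHP _).1 fun j => by rw [hrow, Pi.single_eq_of_ne (hi j)]
  refine ⟨H, hH0, hH, fun x => ?_, hcone⟩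
  by_cases hxp : x = p
  · subst hxp
    exact (hHP _).2.2.1 fun i => eval_coordForm _ _ _
  by_cases hxq : x = q
  · subst hxq
    exact (hHP _).2.2.2 fun i => eval_coordForm _ _ _
  obtain ⟨r, rfl⟩ := hsurj x hxp hxq
  by_cases hr : ∃ j, f j = r
  · obtain ⟨j, rfl⟩ := hr
    exact (hHP _).2.1 ⟨j, fun i hi => by rw [hrow, Pi.single_eq_of_ne (hf.ne hi)]⟩
  · exact Ideal.pow_le_pow_right (Nat.le_succ m) (hcone r (by simpa using hr))

theorem exists_secant_form_even [Fintype τ] {m : ℕ} (hn : n = 2 * m)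
    (hτ : Fintype.card τ = n + 3) {P : τ → ProjSpace K n}
    (hP : InGeneralPosition fun x => (P x).rep) :
    ∃ H : MvPolynomial (Fin (n + 1)) K, H ≠ 0 ∧ H.IsHomogeneous (m + 1) ∧
      ∀ x, H ∈ pointIdeal (P x) ^ m := by
  classical
  subst hn
  obtain ⟨p, q, hpq⟩ := Fintype.exists_pair_of_one_lt_card (α := τ) (by omega)
  obtain ⟨e, he, hp, hq, hsurj, -⟩ := exists_enumeration_compl_pair hτ hpq
  obtain ⟨H, h0, h1, h2, -⟩ := exists_secant_form hP he hpq hp hq hsurj (f := id)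
    Function.injective_id
  exact ⟨H, h0, h1, h2⟩

theorem exists_secant_cone [Fintype τ] {m : ℕ} (hn : n = 2 * m + 1)
    (hτ : Fintype.card τ = n + 3) {P : τ → ProjSpace K n}
    (hP : InGeneralPosition fun x => (P x).rep) (z : τ) :
    ∃ H : MvPolynomial (Fin (n + 1)) K, H ≠ 0 ∧ H.IsHomogeneous (m + 1) ∧
      (∀ x, H ∈ pointIdeal (P x) ^ m) ∧ H ∈ pointIdeal (P z) ^ (m + 1) := by
  classical
  subst hn
  have hcard : 1 < (Finset.univ.erase z).card := by
    rw [Finset.card_erase_of_mem (Finset.mem_univ z), Finset.card_univ]; omega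
  obtain ⟨p, hp', q, hq', hpq⟩ := Finset.one_lt_card.1 hcard
  obtain ⟨e, he, hp, hq, hsurj, -⟩ := exists_enumeration_compl_pair hτ hpq
  obtain ⟨i, rfl⟩ := hsurj z (Finset.ne_of_mem_erase hp').symm (Finset.ne_of_mem_erase hq').symm
  obtain ⟨H, h0, h1, h2, h3⟩ := exists_secant_form hP he hpq hp hq hsurj (f := i.succAbove)
    Fin.succAbove_right_injective
  exact ⟨H, h0, h1, h2, h3 i fun j => Fin.succAbove_ne i j⟩

/-- The product of the secant cones over all choices of the apex. -/
theorem exists_secant_form_odd [Fintype τ] {m : ℕ} (hn : n = 2 * m + 1)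
    (hτ : Fintype.card τ = n + 3) {P : τ → ProjSpace K n}
    (hP : InGeneralPosition fun x => (P x).rep) :
    ∃ H : MvPolynomial (Fin (n + 1)) K, H ≠ 0 ∧
      H.IsHomogeneous ((2 * m + 4) * (m + 1)) ∧
      ∀ x, H ∈ pointIdeal (P x) ^ (2 * m ^ 2 + 4 * m + 1) := by
  classical
  choose H h0 h1 h2 h3 using exists_secant_cone hn hτ hP
  refine ⟨∏ z, H z, Finset.prod_ne_zero_iff.2 fun z _ => h0 z, ?_, fun x => ?_⟩
  · have := MvPolynomial.IsHomogeneous.prod Finset.univ H (fun _ => m + 1) (fun z _ => h1 z)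
    rw [Finset.sum_const, Finset.card_univ, hτ, smul_eq_mul] at this
    convert this using 2
    omega
  -- The cone with apex `x` contributes `m + 1`, each of the other `2 * m + 3` cones contributes
  -- `m`.
  · rw [← Finset.mul_prod_erase _ _ (Finset.mem_univ x)]
    have h4 : ∏ z ∈ Finset.univ.erase x, H z ∈ pointIdeal (P x) ^ ((2 * m + 3) * m) :=
      prod_mem_ideal_pow (Finset.Subset.refl _) (fun z _ => h2 z x) (by
        rw [Finset.card_erase_of_mem (Finset.mem_univ x), Finset.card_univ, hτ, hn,
          show 2 * m + 1 + 3 - 1 = 2 * m + 3 by omega])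
    have := Ideal.mul_mem_mul (h3 x) h4
    rw [← pow_add] at this
    exact Ideal.pow_le_pow_right (by nlinarith) this

end Determinantal

/-! ### Back to point sets: base change, circuits and the constants. -/

section Points

variable {K : Type*} [Field K] {n : ℕ}

theorem card_le_one_of_dim_zero (Z : Finset (ProjSpace K 0)) : Z.card ≤ 1 := by
  refine Finset.card_le_one.2 fun P _ Q _ => ?_
  have hne : ∀ R : ProjSpace K 0, R.rep 0 ≠ 0 := fun R h => R.rep_nonzero (by
    funext i
    rw [show i = 0 from Fin.ext (by omega), h, Pi.zero_apply])
  rw [← P.mk_rep, ← Q.mk_rep, Projectivization.mk_eq_mk_iff']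
  refine ⟨P.rep 0 / Q.rep 0, ?_⟩
  funext i
  rw [show i = 0 from Fin.ext (by omega), Pi.smul_apply, smul_eq_mul, div_mul_cancel₀ _ (hne Q)]

theorem det_ne_zero_of_linearIndependent {p : Fin (n + 1) → ProjSpace K n}
    (h : LinearIndependent K fun i => (p i).rep) : (Matrix.of fun i => (p i).rep).det ≠ 0 := by
  have := (Matrix.linearIndependent_rows_iff_isUnit (A := Matrix.of fun i => (p i).rep)).1 h
  exact ((Matrix.isUnit_iff_isUnit_det _).1 this).ne_zero

theorem LinearlyGeneralPosition.inGeneralPosition {Z : Finset (ProjSpace K n)}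
    (hZ : LinearlyGeneralPosition Z) : InGeneralPosition fun x : Z => (x : ProjSpace K n).rep := by
  classical
  intro e he
  set S : Finset (ProjSpace K n) := Finset.univ.image fun i => (e i : ProjSpace K n)
  have hS : S ⊆ Z := fun P hP => by
    obtain ⟨i, -, rfl⟩ := Finset.mem_image.1 hP
    exact (e i).2
  have h := Projectivization.independent_iff.1 (hZ S hS (Finset.card_image_le.trans (by simp)))
  refine det_ne_zero_of_linearIndependent (p := fun i => (e i : ProjSpace K n))
    (h.comp (fun i => ⟨e i, Finset.mem_image_of_mem _ (Finset.mem_univ i)⟩) fun i j hij => ?_)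
  exact he (Subtype.ext (congrArg (fun x : S => (x : ProjSpace K n)) hij))

theorem map_ne_zero_of_ne_zero (L : Type*) [Field L] [Algebra K L] {σ : Type*}
    {F : MvPolynomial σ K} (hF : F ≠ 0) : MvPolynomial.map (algebraMap K L) F ≠ 0 := fun h =>
  hF (MvPolynomial.map_injective _ (algebraMap K L).injective (by rw [h, map_zero]))

/-- The arc arguments need an infinite field, so the form is moved to the algebraic closure and to
the coordinates in which the `p i` become coordinate points. -/
theorem degree_bound_at_points {p : Fin (n + 1) → ProjSpace K n}
    (hA : (Matrix.of fun i => (p i).rep).det ≠ 0) {Q : ProjSpace K n} {S : Finset (Fin (n + 1))}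
    (hS : ∀ i, i ∈ S ↔ Matrix.vecMul Q.rep (Matrix.of fun i => (p i).rep)⁻¹ i ≠ 0)
    {F : MvPolynomial (Fin (n + 1)) K} {d k : ℕ} (hF : F.IsHomogeneous d) (hF0 : F ≠ 0)
    (hp : ∀ i, F ∈ pointIdeal (p i) ^ k) (hQ : F ∈ pointIdeal Q ^ k) :
    (k : ℤ) ≤ S.card * (d - k) - d + 2 * Sᶜ.card * (d - k) := by
  set A : Matrix (Fin (n + 1)) (Fin (n + 1)) K := Matrix.of fun i => (p i).rep with hAdef
  set L := AlgebraicClosure K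
  set AL : Matrix (Fin (n + 1)) (Fin (n + 1)) L := A.map (algebraMap K L) with hAL
  have hdet : IsUnit AL.det := by
    have : AL.det = algebraMap K L A.det := (RingHom.map_det _ _).symm
    rw [this]
    exact (hA.isUnit).map _
  set c := Matrix.vecMul Q.rep A⁻¹ with hc
  have hcA : Matrix.vecMul c A = Q.rep := by
    rw [Matrix.vecMul_vecMul, Matrix.nonsing_inv_mul A hA.isUnit, Matrix.vecMul_one]
  refine degree_bound_of_circuit (L := L) (isHomogeneous_linSubst AL (hF.map (algebraMap K L)))
    (linSubst_ne_zero hdet (map_ne_zero_of_ne_zero L hF0)) (fun i => VanishesToOrder.linSubst ?_)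
    (c := fun i => algebraMap K L (c i)) (S := S) (fun i => by
      rw [hS, Ne, Ne, FaithfulSMul.algebraMap_eq_zero_iff]) (VanishesToOrder.linSubst ?_)
  · rw [Matrix.single_one_vecMul]
    exact vanishesToOrder_of_mem_pow (hp i)
  · convert vanishesToOrder_of_mem_pow (L := L) hQ using 1
    funext i
    rw [← hcA, hAL]
    exact (RingHom.map_vecMul (algebraMap K L) A c i).symm

theorem degree_bound_at_points_odd {τ : Type*} [Fintype τ] {m : ℕ} (hn : n = 2 * m + 1)
    (hτ : Fintype.card τ = n + 3) {P : τ → ProjSpace K n}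
    (hP : InGeneralPosition fun x => (P x).rep)
    {F : MvPolynomial (Fin (n + 1)) K} {d k : ℕ} (hF : F.IsHomogeneous d) (hF0 : F ≠ 0)
    (h : ∀ x, F ∈ pointIdeal (P x) ^ k) :
    (2 * m + 4) * (m + 1) * k ≤ (2 * m ^ 2 + 4 * m + 1) * d := by
  set L := AlgebraicClosure K
  have E : Fin (m + 2) × Bool ≃ τ := Fintype.equivOfCardEq (by simp [hτ, hn]; omega)
  refine degree_bound_of_odd (L := L) hn
    (v := fun x i => algebraMap K L ((P (E x)).rep i)) (fun e he => ?_)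
    (hF.map (algebraMap K L)) (map_ne_zero_of_ne_zero L hF0)
    (fun x => vanishesToOrder_of_mem_pow (h (E x)))
  have h1 := hP (E ∘ e) (E.injective.comp he)
  have h2 : Matrix.of ((fun x i => algebraMap K L ((P (E x)).rep i)) ∘ e) =
      (algebraMap K L).mapMatrix (Matrix.of ((fun x => (P x).rep) ∘ (E ∘ e))) := rfl
  rw [h2, ← RingHom.map_det]
  exact (map_ne_zero _).2 h1

theorem linIndep_iff {S : Finset (ProjSpace K n)} :
    LinIndep S ↔ LinearIndepOn K Projectivization.rep (S : Set (ProjSpace K n)) :=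
  Projectivization.independent_iff

theorem exists_basis_of_spanning {Z : Finset (ProjSpace K n)} (hZ : Spanning Z) :
    ∃ p : Fin (n + 1) → ProjSpace K n, (∀ i, p i ∈ Z) ∧ Function.Injective p ∧
      LinearIndependent K fun i => (p i).rep := by
  obtain ⟨κ, a, ha, hspan, hli⟩ := exists_linearIndependent' K
    (fun P : Z => (P : ProjSpace K n).rep)
  have htop : Submodule.span K (Set.range fun P : Z => (P : ProjSpace K n).rep) = ⊤ := by
    rw [eq_top_iff, ← hZ, iSup₂_le_iff]
    intro P hP
    rw [Projectivization.submodule_eq, Submodule.span_singleton_le_iff_mem]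
    exact Submodule.subset_span ⟨⟨P, hP⟩, rfl⟩
  rw [htop] at hspan
  have : Finite κ := hli.finite
  have := Fintype.ofFinite κ
  have hcard : Fintype.card κ = n + 1 := by
    have := Module.finrank_eq_card_basis (Module.Basis.mk hli hspan.ge)
    rw [← this]
    simp
  have E : Fin (n + 1) ≃ κ := Fintype.equivOfCardEq (by simp [hcard])
  exact ⟨fun i => a (E i), fun i => (a (E i)).2,
    Subtype.val_injective.comp (ha.comp E.injective), hli.comp E E.injective⟩

/-- A set of `n + 2` spanning points contains a single circuit. -/
theorem card_support_of_isDependencyIndex {Z : Finset (ProjSpace K n)} {t : ℕ}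
    (ht : IsDependencyIndex Z t) {p : Fin (n + 1) → ProjSpace K n} (hpi : Function.Injective p)
    (hp : LinearIndependent K fun i => (p i).rep) {Q : ProjSpace K n} (hQp : ∀ i, p i ≠ Q)
    (hZ : ∀ P, P ∈ Z ↔ P = Q ∨ ∃ i, p i = P) {S : Finset (Fin (n + 1))}
    (hS : ∀ i, i ∈ S ↔ Matrix.vecMul Q.rep (Matrix.of fun i => (p i).rep)⁻¹ i ≠ 0) :
    S.card = t + 1 := by
  classical
  have hA := det_ne_zero_of_linearIndependent hp
  set A : Matrix (Fin (n + 1)) (Fin (n + 1)) K := Matrix.of fun i => (p i).rep with hAdef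
  set c := Matrix.vecMul Q.rep A⁻¹ with hc
  have hcA : ∑ i, c i • (p i).rep = Q.rep := by
    have : Matrix.vecMul c A = Q.rep := by
      rw [Matrix.vecMul_vecMul, Matrix.nonsing_inv_mul A hA.isUnit, Matrix.vecMul_one]
    rw [← this, Matrix.vecMul_eq_sum]
    rfl
  have hpOn : LinearIndepOn K Projectivization.rep (Set.range p) :=
    (linearIndepOn_range_iff hpi _).2 hp
  set C : Finset (ProjSpace K n) := insert Q (S.image p) with hC
  have hQS : Q ∉ S.image p := fun h => by
    obtain ⟨i, -, hi⟩ := Finset.mem_image.1 h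
    exact hQp i hi
  have hCcard : C.card = S.card + 1 := by
    rw [hC, Finset.card_insert_of_notMem hQS, Finset.card_image_of_injective _ hpi]
  have hCZ : C ⊆ Z := by
    intro P hP
    rw [hC, Finset.mem_insert, Finset.mem_image] at hP
    rw [hZ]
    exact hP.imp id fun ⟨i, _, hi⟩ => ⟨i, hi⟩
  have hCdep : ¬ LinIndep C := by
    rw [linIndep_iff, hC, Finset.coe_insert, linearIndepOn_insert (by exact_mod_cast hQS)]
    rintro ⟨-, h⟩
    refine h ?_
    rw [← hcA]
    refine Submodule.sum_mem _ fun i _ => ?_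
    by_cases hi : i ∈ S
    · exact Submodule.smul_mem _ _ (Submodule.subset_span ⟨p i, by
        exact_mod_cast Finset.mem_image_of_mem p hi, rfl⟩)
    · rw [not_not.1 (mt (hS i).2 hi), zero_smul]
      exact zero_mem _
  -- `C` is the unique circuit: without `Q` only basis points remain, and without some `p i`, `i ∈
  -- S`, the point `Q` is outside the span of the remaining basis points, as its `i`-th coordinate
  -- is nonzero.
  have hmin : ∀ T ⊆ Z, ¬ LinIndep T → C ⊆ T := by
    intro T hTZ hT
    have hTQ : ∀ P ∈ T, P = Q ∨ ∃ i, p i = P := fun P hP => (hZ P).1 (hTZ hP)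
    rw [linIndep_iff] at hT
    rw [hC, Finset.insert_subset_iff]
    constructor
    · by_contra hQT
      refine hT (hpOn.mono fun P hP => ?_)
      rcases hTQ P hP with rfl | h
      · exact absurd hP hQT
      · exact h
    · intro P hP
      obtain ⟨i, hi, rfl⟩ := Finset.mem_image.1 hP
      by_contra hiT
      have hQ' : Q ∉ p '' {i}ᶜ := by
        rintro ⟨j, -, hj⟩
        exact hQp j hj
      have hli : LinearIndepOn K Projectivization.rep (insert Q (p '' {i}ᶜ)) := by
        rw [linearIndepOn_insert hQ']
        refine ⟨hpOn.mono (Set.image_subset_range _ _), fun h => (hS i).1 hi ?_⟩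
        have hle : Submodule.span K (Projectivization.rep '' (p '' {i}ᶜ)) ≤
            LinearMap.ker ((LinearMap.proj i).comp (Matrix.vecMulLinear A⁻¹)) := by
          rw [Submodule.span_le]
          rintro _ ⟨_, ⟨j, hj, rfl⟩, rfl⟩
          change Matrix.vecMul (A j) A⁻¹ i = 0
          rw [vecMul_inv_row hA, Pi.single_eq_of_ne (fun h => hj h.symm)]
        exact hle h
      refine hT (hli.mono fun P hPT => ?_)
      rcases hTQ P hPT with rfl | ⟨j, rfl⟩
      · exact Set.mem_insert _ _
      · refine Set.mem_insert_of_mem _ ⟨j, ?_, rfl⟩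
        rintro rfl
        exact hiT hPT
  have hSpos : 0 < S.card := by
    rw [Finset.card_pos]
    by_contra hS0
    rw [Finset.not_nonempty_iff_eq_empty] at hS0
    refine Q.rep_nonzero ?_
    rw [← hcA]
    refine Finset.sum_eq_zero fun i _ => ?_
    rw [not_not.1 (mt (hS i).2 (by simp [hS0])), zero_smul]
  obtain ⟨⟨T, hTZ, hTcard, hT⟩, hleast⟩ := ht
  have h1 := Finset.card_le_card (hmin T hTZ hT)
  have h2 : t ≤ S.card - 1 := hleast ⟨C, hCZ, by omega, hCdep⟩
  omega

theorem hasWaldschmidtConstant_of_card_eq_add_two {Z : Finset (ProjSpace K n)}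
    (hZ : Spanning Z) (hcard : Z.card = n + 2) {t : ℕ} (ht : IsDependencyIndex Z t) :
    HasWaldschmidtConstant Z ((2 * (n : ℝ) + 2 - t) / (2 * n - t)) := by
  classical
  have hn : 0 < n := by
    rcases Nat.eq_zero_or_pos n with rfl | h
    · have := card_le_one_of_dim_zero Z
      omega
    · exact h
  obtain ⟨p, hpZ, hpi, hp⟩ := exists_basis_of_spanning hZ
  have hsub : Finset.univ.image p ⊆ Z := fun P hP => by
    obtain ⟨i, -, rfl⟩ := Finset.mem_image.1 hP
    exact hpZ i
  have hc1 : (Z \ Finset.univ.image p).card = 1 := by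
    rw [Finset.card_sdiff_of_subset hsub, Finset.card_image_of_injective _ hpi, hcard,
      Finset.card_univ, Fintype.card_fin]
    omega
  obtain ⟨Q, hQ⟩ := Finset.card_eq_one.1 hc1
  have hmem : ∀ P, (P ∈ Z ∧ ∀ i, p i ≠ P) ↔ P = Q := fun P => by
    have := Finset.ext_iff.1 hQ P
    simpa using this
  have hQ' := (hmem Q).2 rfl
  have hZ' : ∀ P, P ∈ Z ↔ P = Q ∨ ∃ i, p i = P := fun P => by
    refine ⟨fun hP => ?_, ?_⟩
    · by_contra! h
      exact h.1 ((hmem P).1 ⟨hP, h.2⟩)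
    · rintro (rfl | ⟨i, rfl⟩)
      · exact hQ'.1
      · exact hpZ i
  have hA := det_ne_zero_of_linearIndependent hp
  set S : Finset (Fin (n + 1)) := Finset.univ.filter fun i =>
    Matrix.vecMul Q.rep (Matrix.of fun i => (p i).rep)⁻¹ i ≠ 0
  have hS : ∀ i, i ∈ S ↔ Matrix.vecMul Q.rep (Matrix.of fun i => (p i).rep)⁻¹ i ≠ 0 :=
    fun i => by simp [S]
  have hSt := card_support_of_isDependencyIndex ht hpi hp hQ'.2 hZ' hS
  have hSc : S.card + Sᶜ.card = n + 1 := by rw [Finset.card_add_card_compl, Fintype.card_fin]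
  obtain ⟨H, hH0, hH, hHp, hHQ⟩ := exists_hyperplane_product hA Q hS
  have hpos : 0 < S.card + 2 * Sᶜ.card - 1 := by omega
  have hlim := hasWaldschmidtConstant_of_extremal (Z := Z)
    (Nat.mul_pos (by omega : 0 < S.card) hpos) (mem_symbolicPower.2 fun P hP => by
      rcases (hZ' P).1 hP with rfl | ⟨i, rfl⟩
      · exact hHQ
      · exact hHp i) hH hH0 (fun k d F hF hFd hF0 => by
      have h := degree_bound_at_points hA hS hFd hF0
        (fun i => mem_symbolicPower.1 hF _ (hpZ i)) (mem_symbolicPower.1 hF _ hQ'.1)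
      rw [mul_assoc, mul_assoc]
      refine Nat.mul_le_mul_left _ ?_
      zify [show 1 ≤ S.card + 2 * Sᶜ.card by omega]
      linarith)
  convert hlim using 1
  have h1 : (n : ℝ) = t + Sᶜ.card := by
    have : n = t + Sᶜ.card := by omega
    exact_mod_cast this
  have h2 : (S.card : ℝ) = t + 1 := by exact_mod_cast hSt
  rw [Nat.cast_mul, Nat.cast_mul, mul_div_mul_left _ _ (by rw [h2]; positivity),
    Nat.cast_sub (by omega)]
  push_cast
  rw [h1, h2]
  congr 1 <;> ring

theorem hasWaldschmidtConstant_of_card_eq_add_three_of_even {Z : Finset (ProjSpace K n)}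
    (hcard : Z.card = n + 3) (hZ : LinearlyGeneralPosition Z) (heven : Even n) :
    HasWaldschmidtConstant Z (((n : ℝ) + 2) / n) := by
  classical
  obtain ⟨m, hm⟩ := heven
  have hm0 : 0 < m := by
    rcases Nat.eq_zero_or_pos m with rfl | h
    · subst hm
      have := card_le_one_of_dim_zero Z
      omega
    · exact h
  have hgp := hZ.inGeneralPosition
  have hτ : Fintype.card Z = n + 3 := by rw [Fintype.card_coe, hcard]
  obtain ⟨H, hH0, hH, hHP⟩ := exists_secant_form_even (by omega : n = 2 * m) hτ hgp
  obtain ⟨p, q, hpq⟩ := Fintype.exists_pair_of_one_lt_card (α := Z) (by omega)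
  obtain ⟨e, he, hp, hq, -, -⟩ := exists_enumeration_compl_pair hτ hpq
  have hlim := hasWaldschmidtConstant_of_extremal (Z := Z) hm0
    (mem_symbolicPower.2 fun P hP => hHP ⟨P, hP⟩) hH hH0 (fun k d F hF hFd hF0 => by
      -- The bound from `n + 2` of the points, with full support by general position, is already
      -- sharp.
      have h := degree_bound_at_points (p := fun i => (e i : ProjSpace K n)) (hgp e he)
        (Q := (p : ProjSpace K n)) (S := Finset.univ)
        (fun i => ⟨fun _ => hgp.coord_ne_zero he hp i, fun _ => Finset.mem_univ i⟩) hFd hF0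
        (fun i => mem_symbolicPower.1 hF _ (e i).2) (mem_symbolicPower.1 hF _ p.2)
      simp only [Finset.card_univ, Fintype.card_fin, Finset.compl_univ, Finset.card_empty] at h
      zify
      rw [hm] at h
      push_cast at h
      linarith)
  convert hlim using 1
  have hm' : (m : ℝ) ≠ 0 := by exact_mod_cast hm0.ne'
  rw [hm]
  push_cast
  field_simp
  ring

theorem hasWaldschmidtConstant_of_card_eq_add_three_of_odd {Z : Finset (ProjSpace K n)}
    (hcard : Z.card = n + 3) (hZ : LinearlyGeneralPosition Z) (hodd : Odd n) :
    HasWaldschmidtConstant Z ((((n : ℝ) + 1) * (n + 3)) / ((n : ℝ) ^ 2 + 2 * n - 1)) := by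
  obtain ⟨m, hm⟩ := hodd
  have hgp := hZ.inGeneralPosition
  have hτ : Fintype.card Z = n + 3 := by rw [Fintype.card_coe, hcard]
  obtain ⟨H, hH0, hH, hHP⟩ := exists_secant_form_odd hm hτ hgp
  have hlim := hasWaldschmidtConstant_of_extremal (Z := Z) (by positivity)
    (mem_symbolicPower.2 fun P hP => hHP ⟨P, hP⟩) hH hH0 (fun k d F hF hFd hF0 =>
      degree_bound_at_points_odd hm hτ hgp hFd hF0 fun x => mem_symbolicPower.1 hF _ x.2)
  convert hlim using 1
  have h1 : ((n : ℝ) + 1) * (n + 3) = 2 * ((2 * m + 4) * (m + 1)) := by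
    rw [hm]
    push_cast
    ring
  have h2 : (n : ℝ) ^ 2 + 2 * n - 1 = 2 * (2 * m ^ 2 + 4 * m + 1) := by
    rw [hm]
    push_cast
    ring
  rw [h1, h2, mul_div_mul_left _ _ two_ne_zero]
  push_cast
  rfl

end Points

end FatPoints

theorem proposition5p1 {K : Type*} [Field K] {n : ℕ}
    (Z : Finset (FatPoints.ProjSpace K n)) (hZ : FatPoints.Spanning Z) :
    (Z.card = n + 2 → ∀ t : ℕ, FatPoints.IsDependencyIndex Z t →
      FatPoints.HasWaldschmidtConstant Z
        ((2 * (n : ℝ) + 2 - (t : ℝ)) / (2 * (n : ℝ) - (t : ℝ)))) ∧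
    (Z.card = n + 3 → FatPoints.LinearlyGeneralPosition Z →
      (Even n → FatPoints.HasWaldschmidtConstant Z (((n : ℝ) + 2) / (n : ℝ))) ∧
      (Odd n → FatPoints.HasWaldschmidtConstant Z
        ((((n : ℝ) + 1) * ((n : ℝ) + 3)) / ((n : ℝ) ^ 2 + 2 * (n : ℝ) - 1)))) :=
  ⟨fun hcard _ ht => FatPoints.hasWaldschmidtConstant_of_card_eq_add_two hZ hcard ht,
    fun hcard hgp =>
      ⟨FatPoints.hasWaldschmidtConstant_of_card_eq_add_three_of_even hcard hgp,
        FatPoints.hasWaldschmidtConstant_of_card_eq_add_three_of_odd hcard hgp⟩⟩
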